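/- **Conventions.** For a binary linear code $C\subseteq\mathbb F_2^n$, $C^\perp$ is its dual with respect to $u\cdot v=\sum_i u_iv_i$; $C$ is an $[n,k,d]$ code if $\dim C=k$ and its nonzero words have minimum Hamming weight $d$; $C$ is cyclic if it is closed under cyclic shifts. All quantum codes are in the stabilizer formalism. A *hybrid subsystem code* $[[N,k{:}m,r]]$ is given by Pauli operators $\bar X_i,\bar Z_i$ $(1\le i\le N)$ on $N$ qubits, each of square $I$, such that $\bar X_i$ and $\bar Z_i$ anticommute for each $i$ and all other pairs commute, where $k+m+r\le N$. It has $k$ logical qubits, $m$ classical bits and $r$ gauge qubits, and $$\mathcal S=\langle \bar Z_i: i>k+m+r\rangle,\qquad \mathcal S_C=\langle\bar Z_i: k<i\le k+m\rangle,$$ $$\mathcal G=\langle iI,\ \bar Z_i\ (i>k+m),\ \bar X_i\ (k+m<i\le k+m+r)\rangle,\qquad \mathcal G_0=\langle\mathcal G,\mathcal S_C\rangle.$$ Its minimum distance is the minimum weight of an element of $C(\mathcal S)\setminus\mathcal G_0$, where $C(\mathcal S)$ is the centralizer of $\mathcal S$ in the Pauli group. The constituent code that carries the message $b\in\mathbb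 F_2^m$ has stabilizer group $\mathcal S_b=\langle\mathcal S,\ (-1)^{b_j}\bar Z_{k+j}\ (1\le j\le m)\rangle$. It is a *subsystem code* $[[N,k,r]]$ if $m=0$ and a *hybrid code* $[[N,k{:}m]]$ if $r=0$. Let $t\ge0$ and let $N=n+a_l+a_r$. The *main block* is the set of qubits $a_l+1,\dots,a_l+n$. For $0\le b_l\le a_l$ and $0\le b_r\le a_r$, the code *corrects misalignment by up to $b_l$ positions to the left and $b_r$ to the right* if there is a set of Pauli measurements on $n$ qubits such that, when they are applied to the $n$ consecutive qubits starting at qubit $a_l+1+\alpha$ of a code word, for any integer $\alpha$ with $-b_l\le\alpha\le b_r$, any message $b$, and any Pauli error of weight at most $t$ on these $n$ qubits, all outcomes are determined (each measured operator is, up to sign, in the stabilizer group of the corrupted code word), and the outcomes determine $\alpha$. The code is $(a_l,a_r)$-*synchronizable* if this holds for $b_l=a_l$, $b_r=a_r$, and its *synchronization distance* is the largest $b_l+b_r+1$ for which it holds (so it is $a_l+a_r+1$ for an $(a_l,a_r)$-synchronizable code). A code on $n$ qubits, whose main block is the whole block, is *non-synchronizable* if, when blocks are sent consecutively, for no $0<s<n$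 can a window of $n$ qubits starting $s$ positions late be told from the aligned window by Pauli measurements with determined outcomes, even without Pauli errors; here $a_l=a_r=0$ and the synchronization distance is $1$. **Theorem.** Let $C$ and $D$ be binary cyclic codes with parameters $[n,k_c,d_c]$ and $[n,k_d,d_d]$, with $C^\perp\subsetneq C\subsetneq D$ and $k_c<k_d$. Put $t=\lfloor (d_d-1)/2\rfloor$. Say that a quantum code *has design distance $d_d$* if its minimum distance is at least $d_d$, and is equal to $d_d$ whenever $D$ has a word of weight $d_d$ outside $C^\perp$. Then the following codes with design distance $d_d$ exist. 1. A non-synchronizable subsystem code $\mathcal Q_1$ with parameters $[[n,2k_c-n,2(k_d-k_c)]]$, of synchronization distance $1$. 2. For all integers $a_l,a_r\ge0$ with $a_l+a_r<k_d-k_c$, an $(a_l,a_r)$-synchronizable subsystem code $\mathcal Q_2$ with parameters $[[n+a_l+a_r,2k_c-n,k_d-k_c]]$. The maximum synchronization distance over these $(a_l,a_r)$ is $k_d-k_c$. 3. For all integers $a_l,a_r\ge0$ with $a_l+a_r<k_d-k_c$, an $(a_l,a_r)$-synchronizable hybrid code $\mathcal Q_3$ with parameters $[[n+a_l+a_r,2k_c-n{:}k_d-k_c]]$.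 The maximum synchronization distance over these $(a_l,a_r)$ is $k_d-k_c$. 4. For every integer $y\in\{1,\dots,k_d-k_c-2\}$ and all integers $a_l,a_r\ge0$ with $a_l+a_r<k_d-k_c-y$, an $(a_l,a_r)$-synchronizable hybrid code $\mathcal Q_4$ with parameters $[[n+a_l+a_r,2k_c-n{:}k_d-k_c+y]]$. For each $y$, the maximum synchronization distance over these $(a_l,a_r)$ is $k_d-k_c-y$. 5. A non-synchronizable hybrid code $\mathcal Q_5$ with parameters $[[n,2k_c-n{:}2(k_d-k_c)]]$, of synchronization distance $1$. 6. For every integer $y\in\{1,\dots,k_d-k_c-2\}$ and all integers $a_l,a_r\ge0$ with $a_l+a_r<k_d-k_c-y$, an $(a_l,a_r)$-synchronizable hybrid subsystem code $\mathcal Q_6$ with parameters $[[n+a_l+a_r,2k_c-n{:}y,k_d-k_c]]$. For each $y$, the maximum synchronization distance over these $(a_l,a_r)$ is $k_d-k_c-y$. 7. A non-synchronizable hybrid subsystem code $\mathcal Q_7$ with parameters $[[n,2k_c-n{:}k_d-k_c,k_d-k_c]]$, of synchronization distance $1$. -/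

import Mathlib

/-! ## Classical binary codes -/

/-- The dual code `{w | c · w = 0 for all c ∈ C}`. -/
def dualCode {n : ℕ} (C : Submodule (ZMod 2) (Fin n → ZMod 2)) :
    Submodule (ZMod 2) (Fin n → ZMod 2) where
  carrier := {w | ∀ c ∈ C, dotProduct c w = 0}
  zero_mem' := fun c _ => dotProduct_zero c
  add_mem' := fun {a b} ha hb c hc => by
    rw [dotProduct_add, ha c hc, hb c hc, add_zero]
  smul_mem' := fun r a ha c hc => by
    rw [dotProduct_smul, ha c hc, smul_zero]

/-- Every cyclic shift of a code word is a code word. -/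
def IsCyclicCode {n : ℕ} (C : Submodule (ZMod 2) (Fin n → ZMod 2)) : Prop :=
  ∀ c ∈ C, ∀ a : ℕ, (fun i => c (((finRotate n) ^ a) i)) ∈ C

/-- `C` is an `[n, k, d]` code: its dimension is `k` and the minimum Hamming weight of its nonzero
words is `d`. -/
def IsLinearCode {n : ℕ} (C : Submodule (ZMod 2) (Fin n → ZMod 2)) (k d : ℕ) : Prop :=
  Module.finrank (ZMod 2) C = k ∧ IsLeast {w | ∃ c ∈ C, c ≠ 0 ∧ hammingNorm c = w} d

/-! ## The Pauli group -/

/-- The homomorphism `ZMod 2 → ZMod 4` sending `1` to `2`, so that `i ^ half a = (-1) ^ a`. -/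
def half (a : ZMod 2) : ZMod 4 := 2 * (a.val : ZMod 4)

theorem half_add (a b : ZMod 2) : half (a + b) = half a + half b := by
  revert a b; decide

theorem half_add_self (a : ZMod 2) : half a + half a = 0 := by
  revert a; decide

/-- An `n`-qubit Pauli operator: `⟨p, x, z⟩` stands for `i ^ p • X(x) Z(z)`, where
`X(x) = X ^ x₀ ⊗ ⋯ ⊗ X ^ xₙ₋₁` and `Z(z) = Z ^ z₀ ⊗ ⋯ ⊗ Z ^ zₙ₋₁`. Every element of the `n`-qubit Pauli
group (with phases `±1, ±i`) has exactly one such form. -/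
@[ext] structure Pauli (n : ℕ) where
  phase : ZMod 4
  x : Fin n → ZMod 2
  z : Fin n → ZMod 2

namespace Pauli

variable {n : ℕ}

/-- Operator product, from `Z(z) X(x) = (-1) ^ (z · x) X(x) Z(z)`. -/
instance : Mul (Pauli n) :=
  ⟨fun P Q => ⟨P.phase + Q.phase + half (dotProduct P.z Q.x), P.x + Q.x, P.z + Q.z⟩⟩

instance : One (Pauli n) := ⟨⟨0, 0, 0⟩⟩

instance : Inv (Pauli n) := ⟨fun P => ⟨-P.phase + half (dotProduct P.z P.x), P.x, P.z⟩⟩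

theorem mul_def (P Q : Pauli n) :
    P * Q = ⟨P.phase + Q.phase + half (dotProduct P.z Q.x), P.x + Q.x, P.z + Q.z⟩ := rfl

theorem one_def : (1 : Pauli n) = ⟨0, 0, 0⟩ := rfl

theorem inv_def (P : Pauli n) :
    P⁻¹ = ⟨-P.phase + half (dotProduct P.z P.x), P.x, P.z⟩ := rfl

instance : Group (Pauli n) :=
  Group.ofLeftAxioms
    (fun P Q R => by
      simp only [mul_def, dotProduct_add, add_dotProduct, half_add]
      ext1
      · ring
      · exact add_assoc _ _ _
      · exact add_assoc _ _ _)
    (fun P => by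
      simp [mul_def, one_def, half])
    (fun P => by
      simp only [mul_def, one_def, inv_def]
      ext1
      · have h := half_add_self (dotProduct P.z P.x)
        linear_combination h
      · exact funext fun i => CharTwo.add_self_eq_zero (P.x i)
      · exact funext fun i => CharTwo.add_self_eq_zero (P.z i))

/-- The scalar operator `(-1) ^ a`. -/
def sign (a : ZMod 2) : Pauli n := ⟨half a, 0, 0⟩

/-- The scalar operator `i`. -/
def imag : Pauli n := ⟨1, 0, 0⟩

/-- The number of non-identity tensor factors. -/
def weight (P : Pauli n) : ℕ :=
  (Finset.univ.filter fun j => P.x j ≠ 0 ∨ P.z j ≠ 0).card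

/-- The operator on `N` qubits acting as `P` on the `n` consecutive qubits `s, …, s + n - 1` (counted
from `0`) and as the identity elsewhere. -/
def place (N s : ℕ) (P : Pauli n) : Pauli N where
  phase := P.phase
  x := fun j => if h : s ≤ j.val ∧ j.val - s < n then P.x ⟨j.val - s, h.2⟩ else 0
  z := fun j => if h : s ≤ j.val ∧ j.val - s < n then P.z ⟨j.val - s, h.2⟩ else 0

/-- Let `ψ` be any state of `N` qubits stabilized by `S`, and let the error `E` hit the window of `n`
consecutive qubits that starts at qubit `s`. `Yields S s E P a` says that measuring `P` on that window
then gives the eigenvalue `(-1) ^ a` with certainty (and leaves the state unchanged): the operator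
`(-1) ^ a P` belongs to the stabilizer `E S E⁻¹` of the corrupted state. -/
def Yields {N : ℕ} (S : Subgroup (Pauli N)) (s : ℕ) (E P : Pauli n) (a : ZMod 2) : Prop :=
  (place N s E)⁻¹ * (sign a * place N s P) * place N s E ∈ S

end Pauli

/-! ## Hybrid subsystem codes in the stabilizer formalism -/

/-- A hybrid subsystem code on `N` physical qubits with `k` logical qubits, `m` classical bits and `r`
gauge qubits, given by its virtual Pauli operators: the images `X i`, `Z i` of the single-qubit Pauli
operators under a Clifford encoder, which are exactly the families of Pauli operators satisfying the
relations below. The virtual qubits are, in this order: `k` logical qubits, `m` qubits that carry the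
classical bits (`X i` translates between messages, `Z i` is a classical stabilizer), `r` gauge qubits,
and `N - k - m - r` ancilla qubits (`Z i` is a stabilizer). -/
structure HybridSubsystemCode (N k m r : ℕ) where
  X : Fin N → Pauli N
  Z : Fin N → Pauli N
  size_le : k + m + r ≤ N
  X_mul_self : ∀ i, X i * X i = 1
  Z_mul_self : ∀ i, Z i * Z i = 1
  X_comm : ∀ i j, Commute (X i) (X j)
  Z_comm : ∀ i j, Commute (Z i) (Z j)
  XZ_comm : ∀ i j, i ≠ j → Commute (X i) (Z j)
  XZ_anticomm : ∀ i, X i * Z i = Pauli.sign 1 * (Z i * X i)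

/-- A subsystem code has no classical bits. -/
abbrev SubsystemCode (N k r : ℕ) := HybridSubsystemCode N k 0 r

/-- A hybrid code has no gauge qubits. -/
abbrev HybridCode (N k m : ℕ) := HybridSubsystemCode N k m 0

namespace HybridSubsystemCode

variable {N k m r : ℕ}

/-- The outer stabilizer group `S = S_Q`. -/
def outerStabilizer (Q : HybridSubsystemCode N k m r) : Subgroup (Pauli N) :=
  Subgroup.closure {P | ∃ i : Fin N, k + m + r ≤ i.val ∧ P = Q.Z i}

/-- The group `S_C` of classical stabilizers. -/
def classicalStabilizer (Q : HybridSubsystemCode N k m r) : Subgroup (Pauli N) :=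
  Subgroup.closure {P | ∃ i : Fin N, k ≤ i.val ∧ i.val < k + m ∧ P = Q.Z i}

/-- The outer gauge group `G`, generated by the scalar `i`, the gauge operators and the stabilizers. -/
def gaugeGroup (Q : HybridSubsystemCode N k m r) : Subgroup (Pauli N) :=
  Subgroup.closure ({Pauli.imag} ∪ {P | ∃ i : Fin N, k + m ≤ i.val ∧ P = Q.Z i} ∪
    {P | ∃ i : Fin N, k + m ≤ i.val ∧ i.val < k + m + r ∧ P = Q.X i})

/-- The inner gauge group `G₀ = ⟨G, S_C⟩`. -/
def innerGaugeGroup (Q : HybridSubsystemCode N k m r) : Subgroup (Pauli N) :=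
  Q.gaugeGroup ⊔ Q.classicalStabilizer

/-- The minimum distance: the minimum weight of an element of `C(S) \ G₀`. -/
noncomputable def minDistance (Q : HybridSubsystemCode N k m r) : ℕ :=
  sInf {w | ∃ P ∈ Subgroup.centralizer (Q.outerStabilizer : Set (Pauli N)),
    P ∉ Q.innerGaugeGroup ∧ P.weight = w}

/-- The stabilizer group of the constituent (inner) code that carries the classical message `b`. -/
def messageStabilizer (Q : HybridSubsystemCode N k m r) (b : Fin m → ZMod 2) :
    Subgroup (Pauli N) :=
  Subgroup.closure
    ({P | ∃ j : Fin m, P = Pauli.sign (b j) *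
        Q.Z ⟨k + j.val, by have h1 := Q.size_le; have h2 := j.isLt; omega⟩} ∪
      {P | ∃ i : Fin N, k + m + r ≤ i.val ∧ P = Q.Z i})

/-! ### Block synchronization

The main block consists of the `n` qubits `al, …, al + n - 1` of the transmitted block. -/

/-- The code corrects misalignment by up to `bl` positions to the left and up to `br` positions to the
right, in the presence of up to `t` Pauli errors: there is a set `M` of Pauli measurements on the `n`
received qubits such that, wherever the received window starts (at most `bl` positions before and at most
`br` positions after the first qubit `al` of the main block), whatever the message is and whatever Pauli
error of weight at most `t` hits the window, all the outcomes are determined (so that the encoded state is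
not disturbed), and the outcomes identify the position of the window. -/
def CorrectsMisalignment (Q : HybridSubsystemCode N k m r) (n al bl br t : ℕ) : Prop :=
  ∃ M : Set (Pauli n),
    (∀ P ∈ M, ∀ s, al ≤ s + bl → s ≤ al + br → ∀ b : Fin m → ZMod 2,
      ∀ E : Pauli n, E.weight ≤ t → ∃ a, Pauli.Yields (Q.messageStabilizer b) s E P a) ∧
    (∀ s s', al ≤ s + bl → s ≤ al + br → al ≤ s' + bl → s' ≤ al + br → s ≠ s' →
      ∀ b b' : Fin m → ZMod 2, ∀ E E' : Pauli n, E.weight ≤ t → E'.weight ≤ t →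
        ∃ P ∈ M, ∃ a a', a ≠ a' ∧ Pauli.Yields (Q.messageStabilizer b) s E P a ∧
          Pauli.Yields (Q.messageStabilizer b') s' E' P a')

/-- The synchronization distance of a code whose main block of length `n` is preceded by `al` and followed
by `ar` further qubits of the transmitted block: the greatest `bl + br + 1` such that misalignment by up to
`bl` positions to the left and `br` positions to the right can be corrected. -/
noncomputable def syncDistance (Q : HybridSubsystemCode N k m r) (n al ar t : ℕ) : ℕ :=
  sSup {d | ∃ bl br, bl ≤ al ∧ br ≤ ar ∧ Q.CorrectsMisalignment n al bl br t ∧ d = bl + br + 1}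

/-- The stabilizer group of two consecutive transmitted blocks that carry the messages `b` and `b'`. -/
def twoBlockStabilizer (Q : HybridSubsystemCode N k m r) (b b' : Fin m → ZMod 2) :
    Subgroup (Pauli (N + N)) :=
  Subgroup.closure (Pauli.place (N + N) 0 '' (Q.messageStabilizer b : Set (Pauli N)) ∪
    Pauli.place (N + N) N '' (Q.messageStabilizer b' : Set (Pauli N)))

/-- The code cannot correct any synchronization error. When blocks are sent one after the other, the
receiver's window of `N` qubits may start `s` positions too late, `0 < s < N` (`s` positions too late in one
block is `N - s` positions too early for the next). Even without Pauli errors, no set of measurements with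
determined outcomes tells such a window from the correctly aligned one. -/
def NonSynchronizable (Q : HybridSubsystemCode N k m r) : Prop :=
  ∀ s, 0 < s → s < N → ¬ ∃ M : Set (Pauli N),
    (∀ P ∈ M, ∀ b b' : Fin m → ZMod 2,
      (∃ a, Pauli.Yields (Q.twoBlockStabilizer b b') 0 1 P a) ∧
      (∃ a, Pauli.Yields (Q.twoBlockStabilizer b b') s 1 P a)) ∧
    (∀ b₁ b₂ b₃ b₄ : Fin m → ZMod 2, ∃ P ∈ M, ∃ a a', a ≠ a' ∧
      Pauli.Yields (Q.twoBlockStabilizer b₁ b₂) 0 1 P a ∧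
      Pauli.Yields (Q.twoBlockStabilizer b₃ b₄) s 1 P a')

end HybridSubsystemCode

/-- The minimum distance of `Q` is at least `d`, the minimum distance of `D`; it is exactly `d` if `D` has
a code word of weight `d` outside the dual of `C`. -/
def HasDesignDistance {n N k m r : ℕ} (C D : Submodule (ZMod 2) (Fin n → ZMod 2)) (d : ℕ)
    (Q : HybridSubsystemCode N k m r) : Prop :=
  d ≤ Q.minDistance ∧
    ((∃ c ∈ D, c ∉ dualCode C ∧ hammingNorm c = d) → Q.minDistance = d)

/-!
All the codes are of CSS type: in dual bases `e`, `f` of `(ZMod 2) ^ N`, each virtual qubit has the pair of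
operators `X(e i)`, `Z(f i)`, and only the choice of which of the two is the stabilizer `Z i`, and a sign on
the `Z(f i)`, remain (`cssCode`). The basis `e` is adapted to the flag
`dualCode D ≤ C ≤ H ≤ D` of codes, extended periodically from length `n` to length `N = n + al + ar`. The
`X`-type stabilizers are the extensions of `dualCode D`, the `Z`-type stabilizers are the words orthogonal to
the extension of `H`, and the vectors of `C` outside `dualCode D` and of `H` outside `C` are distributed
over logical qubits, classical bits and gauge qubits.

**Distance** (`hasDesignDistance_cssCode`). An operator in the centralizer of the stabilizer has an `X`-part
that extends a word of `D`, and a `Z`-part that folds modulo `n` to a word of `D`; so either its weight is at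
least `d`, or both words vanish and it is a stabilizer up to a scalar. The bound is attained by `Z(c)` for a
word `c` of `D` of weight `d` outside `dualCode C`, if the first logical basis vector is the extension of a
word `u` of `C` with `c · u = 1`: the `Z`-parts of the inner gauge group are orthogonal to the logical basis
vectors.

**Synchronization** (`correctsMisalignment_cssCode`). `D` is generated by the cyclic shifts `T ^ j g` of one
word `g`, and the first `kd - kc` of them are a basis of `D` modulo `C` (`pow_notMem_shiftFlag`). The code
words are translated by `T ^ y g`, and `H` is spanned by `C` and `T ^ j g`, `j < y`, so that the message
changes the translation only within `H`. On the window that starts at `s`, the parity checks `Z(w)`,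
`w ∈ dualCode C`, return the coset modulo `C` of `T ^ s (T ^ y g + h) + x`, where `h ∈ H` depends on the
message and `x` is the error. Modulo `D` this is the coset of `x`, which determines `x` as `2 t < d`. What
remains has the leading term `T ^ (y + s) g`, which determines `s` as long as `y + s < kd - kc`
(`shift_add_shift_notMem`).

**Non-synchronizable codes** (`nonSynchronizable_of_le_cssGroup`). Without the translation, the stabilizer
group of the message `0` consists of operators `X(x) Z(z)` with sign `+`, and so does that of two consecutive
blocks. A measurement whose outcome is determined on two windows therefore gives the same outcome on both.
-/

/-! ### Duality of binary codes -/

theorem zmod_two_eq_zero_or_one : ∀ a : ZMod 2, a = 0 ∨ a = 1 := by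
  decide

theorem word_add_self {n : ℕ} (u : Fin n → ZMod 2) : u + u = 0 :=
  funext fun i => CharTwo.add_self_eq_zero (u i)

theorem word_add_add_self {n : ℕ} (u v : Fin n → ZMod 2) : u + v + u = v := by
  rw [add_right_comm, word_add_self, zero_add]

theorem dualCode_eq_orthogonal {n : ℕ} (C : Submodule (ZMod 2) (Fin n → ZMod 2)) :
    dualCode C = LinearMap.BilinForm.orthogonal (dotProductBilin (ZMod 2) (ZMod 2)) C := by
  ext w
  rfl

theorem nondegenerate_dotProductBilin (n : ℕ) :
    LinearMap.BilinForm.Nondegenerate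
      (dotProductBilin (ZMod 2) (ZMod 2) : LinearMap.BilinForm (ZMod 2) (Fin n → ZMod 2)) := by
  constructor
  · intro v h
    exact dotProduct_eq_zero v fun w => h w
  · intro v h
    exact dotProduct_eq_zero v fun w => (dotProduct_comm v w).trans (h w)

theorem isRefl_dotProductBilin (n : ℕ) :
    LinearMap.BilinForm.IsRefl
      (dotProductBilin (ZMod 2) (ZMod 2) : LinearMap.BilinForm (ZMod 2) (Fin n → ZMod 2)) :=
  fun v w h => (dotProduct_comm w v).trans h

theorem dualCode_dualCode {n : ℕ} (C : Submodule (ZMod 2) (Fin n → ZMod 2)) :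
    dualCode (dualCode C) = C := by
  rw [dualCode_eq_orthogonal, dualCode_eq_orthogonal]
  exact LinearMap.BilinForm.orthogonal_orthogonal (nondegenerate_dotProductBilin n)
    (isRefl_dotProductBilin n) C

theorem finrank_dualCode {n : ℕ} (C : Submodule (ZMod 2) (Fin n → ZMod 2)) :
    Module.finrank (ZMod 2) (dualCode C) = n - Module.finrank (ZMod 2) C := by
  rw [dualCode_eq_orthogonal,
    LinearMap.BilinForm.finrank_orthogonal (nondegenerate_dotProductBilin n) C,
    Module.finrank_fin_fun]

theorem dualCode_anti {n : ℕ} {C D : Submodule (ZMod 2) (Fin n → ZMod 2)} (h : C ≤ D) :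
    dualCode D ≤ dualCode C :=
  fun _ hw c hc => hw c (h hc)

/-- A word outside `C` is detected by a parity check of `C`. -/
theorem exists_mem_dualCode_dotProduct_eq_one {n : ℕ} {C : Submodule (ZMod 2) (Fin n → ZMod 2)}
    {q : Fin n → ZMod 2} (hq : q ∉ C) : ∃ w ∈ dualCode C, dotProduct w q = 1 := by
  by_contra! h
  refine hq ?_
  rw [← dualCode_dualCode C]
  exact fun w hw => (zmod_two_eq_zero_or_one _).resolve_right (h w hw)

/-! ### Cyclic shifts -/

/-- The cyclic shift `u ↦ (u₁, …, uₙ₋₁, u₀)`. -/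
def cyclicShift (n : ℕ) : Module.End (ZMod 2) (Fin n → ZMod 2) :=
  LinearMap.funLeft (ZMod 2) (ZMod 2) (finRotate n)

theorem cyclicShift_pow_apply {n : ℕ} (s : ℕ) (u : Fin n → ZMod 2) (i : Fin n) :
    (cyclicShift n ^ s) u i = u ((finRotate n ^ s) i) := by
  induction s generalizing i with
  | zero => rfl
  | succ s ih =>
    rw [pow_succ', pow_succ]
    exact ih _

theorem finRotate_pow_apply {n : ℕ} (s : ℕ) (i : Fin n) :
    (finRotate n ^ s) i = ⟨(s + i) % n, Nat.mod_lt _ i.pos⟩ := by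
  induction s with
  | zero => ext; simp [Nat.mod_eq_of_lt i.isLt]
  | succ s ih =>
    have := i.neZero
    rw [pow_succ', Equiv.Perm.mul_apply, ih, finRotate_apply]
    ext
    simp only [Fin.val_add, Fin.val_one']
    rw [← Nat.add_mod]
    congr 1
    ring

theorem IsCyclicCode.cyclicShift_pow_mem {n : ℕ} {C : Submodule (ZMod 2) (Fin n → ZMod 2)}
    (hC : IsCyclicCode C) {c : Fin n → ZMod 2} (hc : c ∈ C) (s : ℕ) :
    (cyclicShift n ^ s) c ∈ C := by
  convert hC c hc s using 1
  exact funext fun i => cyclicShift_pow_apply s c i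

theorem IsCyclicCode.cyclicShift_mem {n : ℕ} {C : Submodule (ZMod 2) (Fin n → ZMod 2)}
    (hC : IsCyclicCode C) {c : Fin n → ZMod 2} (hc : c ∈ C) : cyclicShift n c ∈ C := by
  simpa using hC.cyclicShift_pow_mem hc 1

theorem aeval_cyclicShift_mem {n : ℕ} {K : Submodule (ZMod 2) (Fin n → ZMod 2)}
    (hK : ∀ c ∈ K, cyclicShift n c ∈ K) (p : Polynomial (ZMod 2)) {c : Fin n → ZMod 2}
    (hc : c ∈ K) : Polynomial.aeval (cyclicShift n) p c ∈ K := by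
  induction p using Polynomial.induction_on' with
  | add p q hp hq =>
    rw [map_add]
    exact K.add_mem hp hq
  | monomial j a =>
    rw [Polynomial.aeval_monomial, ← Algebra.smul_def]
    refine K.smul_mem a ?_
    induction j with
    | zero => simpa using hc
    | succ j ih =>
      rw [pow_succ']
      exact hK _ ih

/-- The unit word at position `0` generates all words under polynomials in the shift. -/
theorem exists_aeval_cyclicShift_single {n : ℕ} [NeZero n] (c : Fin n → ZMod 2) :
    ∃ p : Polynomial (ZMod 2), Polynomial.aeval (cyclicShift n) p (Pi.single 0 1) = c := by
  let R : Submodule (ZMod 2) (Fin n → ZMod 2) :=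
    { carrier := {c | ∃ p : Polynomial (ZMod 2),
        Polynomial.aeval (cyclicShift n) p (Pi.single 0 1) = c}
      zero_mem' := ⟨0, by simp⟩
      add_mem' := by
        rintro _ _ ⟨p, rfl⟩ ⟨q, rfl⟩
        exact ⟨p + q, by simp⟩
      smul_mem' := by
        rintro a _ ⟨p, rfl⟩
        exact ⟨a • p, by simp⟩ }
  suffices R = ⊤ from (this ▸ Submodule.mem_top : c ∈ R)
  rw [eq_top_iff, ← (Pi.basisFun (ZMod 2) (Fin n)).span_eq, Submodule.span_le]
  rintro _ ⟨i, rfl⟩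
  -- `T` moves position `j + 1` to position `j`, so `n - i` steps take the unit word at `0` to that at `i`.
  refine ⟨Polynomial.X ^ (n - i.val), ?_⟩
  ext j
  rw [map_pow, Polynomial.aeval_X, cyclicShift_pow_apply, finRotate_pow_apply, Pi.basisFun_apply,
    Pi.single_apply, Pi.single_apply]
  congr 1
  rw [eq_iff_iff, Fin.ext_iff, Fin.ext_iff]
  simp only [Fin.val_zero]
  have hi := i.isLt
  have hj := j.isLt
  rw [← Nat.dvd_iff_mod_eq_zero]
  constructor
  · rintro ⟨q, hq⟩
    have h1 : 0 < q := Nat.pos_of_ne_zero (by rintro rfl; omega)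
    have h2 : q < 2 := by
      by_contra! h2
      have := Nat.mul_le_mul_left n h2
      omega
    obtain rfl : q = 1 := by omega
    omega
  · intro h
    exact ⟨1, by omega⟩

/-- A cyclic code is generated, under polynomials in the shift, by a single word: it corresponds to
an ideal of the principal ideal domain `(ZMod 2)[X]`. -/
theorem IsCyclicCode.exists_generator {n : ℕ} [NeZero n]
    {D : Submodule (ZMod 2) (Fin n → ZMod 2)} (hD : IsCyclicCode D) :
    ∃ g ∈ D, ∀ c ∈ D, ∃ p : Polynomial (ZMod 2), Polynomial.aeval (cyclicShift n) p g = c := by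
  let I : Ideal (Polynomial (ZMod 2)) :=
    { carrier := {p | Polynomial.aeval (cyclicShift n) p (Pi.single 0 1) ∈ D}
      zero_mem' := by simp
      add_mem' := by
        intro p q hp hq
        simpa using D.add_mem hp hq
      smul_mem' := by
        intro p q hq
        simpa using aeval_cyclicShift_mem (fun c hc => hD.cyclicShift_mem hc) p hq }
  obtain ⟨q, hq⟩ := (IsPrincipalIdealRing.principal I).principal
  have hqI : q ∈ I := hq ▸ Submodule.mem_span_singleton_self q
  refine ⟨Polynomial.aeval (cyclicShift n) q (Pi.single 0 1), hqI, fun c hc => ?_⟩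
  obtain ⟨p, rfl⟩ := exists_aeval_cyclicShift_single c
  have hp : p ∈ I := hc
  rw [hq, Submodule.mem_span_singleton] at hp
  obtain ⟨r, rfl⟩ := hp
  exact ⟨r, by simp⟩

/-- The code spanned by `C` and the first `j` shifts `g, T g, …, T ^ (j - 1) g` of `g`. -/
def shiftFlag {n : ℕ} (C : Submodule (ZMod 2) (Fin n → ZMod 2)) (g : Fin n → ZMod 2) :
    ℕ → Submodule (ZMod 2) (Fin n → ZMod 2)
  | 0 => C
  | j + 1 => shiftFlag C g j ⊔ Submodule.span (ZMod 2) {(cyclicShift n ^ j) g}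

section ShiftFlag

variable {n : ℕ} {C D : Submodule (ZMod 2) (Fin n → ZMod 2)} {g : Fin n → ZMod 2}

theorem shiftFlag_mono (C : Submodule (ZMod 2) (Fin n → ZMod 2)) (g : Fin n → ZMod 2) :
    Monotone (shiftFlag C g) :=
  monotone_nat_of_le_succ fun _ => le_sup_left

theorem pow_mem_shiftFlag_succ (C : Submodule (ZMod 2) (Fin n → ZMod 2)) (g : Fin n → ZMod 2)
    (j : ℕ) : (cyclicShift n ^ j) g ∈ shiftFlag C g (j + 1) :=
  Submodule.mem_sup_right (Submodule.mem_span_singleton_self _)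

theorem shiftFlag_le (hD : IsCyclicCode D) (hCD : C ≤ D) (hg : g ∈ D) (j : ℕ) :
    shiftFlag C g j ≤ D := by
  induction j with
  | zero => exact hCD
  | succ j ih =>
    exact sup_le ih ((Submodule.span_singleton_le_iff_mem _ _).2 (hD.cyclicShift_pow_mem hg j))

theorem cyclicShift_mem_shiftFlag (hC : IsCyclicCode C) (j : ℕ) :
    ∀ c ∈ shiftFlag C g j, cyclicShift n c ∈ shiftFlag C g (j + 1) := by
  induction j with
  | zero => exact fun c hc => shiftFlag_mono C g (Nat.zero_le 1) (hC.cyclicShift_mem hc)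
  | succ j ih =>
    intro c hc
    obtain ⟨x, hx, y, hy, rfl⟩ := Submodule.mem_sup.1 hc
    obtain ⟨a, rfl⟩ := Submodule.mem_span_singleton.1 hy
    rw [map_add, map_smul]
    refine Submodule.add_mem _ (shiftFlag_mono C g (Nat.le_succ _) (ih x hx))
      (Submodule.smul_mem _ a ?_)
    have := pow_mem_shiftFlag_succ C g (j + 1)
    rwa [pow_succ'] at this

theorem cyclicShift_pow_mem_shiftFlag (hC : IsCyclicCode C) {j : ℕ} {c : Fin n → ZMod 2}
    (hc : c ∈ shiftFlag C g j) (s : ℕ) : (cyclicShift n ^ s) c ∈ shiftFlag C g (j + s) := by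
  induction s with
  | zero => exact hc
  | succ s ih =>
    rw [pow_succ']
    exact cyclicShift_mem_shiftFlag hC _ _ ih

theorem finrank_shiftFlag_succ_le (C : Submodule (ZMod 2) (Fin n → ZMod 2)) (g : Fin n → ZMod 2)
    (j : ℕ) : Module.finrank (ZMod 2) (shiftFlag C g (j + 1)) ≤
      Module.finrank (ZMod 2) (shiftFlag C g j) + 1 :=
  (Submodule.finrank_add_le_finrank_add_finrank _ _).trans
    (Nat.add_le_add_left ((finrank_span_le_card _).trans (by simp)) _)

theorem finrank_shiftFlag_le (C : Submodule (ZMod 2) (Fin n → ZMod 2)) (g : Fin n → ZMod 2)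
    (j : ℕ) : Module.finrank (ZMod 2) (shiftFlag C g j) ≤ Module.finrank (ZMod 2) C + j := by
  induction j with
  | zero => exact le_rfl
  | succ j ih => exact (finrank_shiftFlag_succ_le C g j).trans (by omega)

/-- If `T ^ j g` already lay in the span of `C` and the earlier shifts, that span would be invariant
under shifts, hence all of `D`, which has too large a dimension. -/
theorem pow_notMem_shiftFlag (hC : IsCyclicCode C)
    (hgen : ∀ c ∈ D, ∃ p : Polynomial (ZMod 2), Polynomial.aeval (cyclicShift n) p g = c) {j : ℕ}
    (hj : Module.finrank (ZMod 2) C + j < Module.finrank (ZMod 2) D) :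
    (cyclicShift n ^ j) g ∉ shiftFlag C g j := by
  intro h
  have heq : shiftFlag C g (j + 1) = shiftFlag C g j :=
    sup_eq_left.2 ((Submodule.span_singleton_le_iff_mem _ _).2 h)
  have hg : g ∈ shiftFlag C g j :=
    heq ▸ shiftFlag_mono C g (Nat.le_add_left 1 j) (pow_mem_shiftFlag_succ C g 0)
  have hDK : D ≤ shiftFlag C g j := by
    intro c hc
    obtain ⟨p, rfl⟩ := hgen c hc
    exact aeval_cyclicShift_mem (fun c hc => heq ▸ cyclicShift_mem_shiftFlag hC j c hc) p hg
  have h1 := Submodule.finrank_mono hDK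
  have h2 := finrank_shiftFlag_le C g j
  omega

theorem finrank_shiftFlag (hC : IsCyclicCode C)
    (hgen : ∀ c ∈ D, ∃ p : Polynomial (ZMod 2), Polynomial.aeval (cyclicShift n) p g = c) {j : ℕ}
    (hj : Module.finrank (ZMod 2) C + j ≤ Module.finrank (ZMod 2) D) :
    Module.finrank (ZMod 2) (shiftFlag C g j) = Module.finrank (ZMod 2) C + j := by
  induction j with
  | zero => rfl
  | succ j ih =>
    refine le_antisymm (finrank_shiftFlag_le C g _) ?_
    have h1 := ih (by omega)
    have h2 : shiftFlag C g j < shiftFlag C g (j + 1) :=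
      lt_of_le_of_ne le_sup_left fun h => pow_notMem_shiftFlag hC hgen (by omega)
        (h ▸ pow_mem_shiftFlag_succ C g j)
    have h3 := Submodule.finrank_lt_finrank_of_lt h2
    omega

/-- Modulo `C`, the shifts by `s' < s` of words in the coset `T ^ y g + ⟨C, g, …, T ^ (y - 1) g⟩` have
different leading terms `T ^ (y + s') g` and `T ^ (y + s) g`. -/
theorem shift_add_shift_notMem (hC : IsCyclicCode C)
    (hgen : ∀ c ∈ D, ∃ p : Polynomial (ZMod 2), Polynomial.aeval (cyclicShift n) p g = c)
    {y s s' : ℕ} (hss : s' < s)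
    (hs : Module.finrank (ZMod 2) C + (y + s) < Module.finrank (ZMod 2) D)
    {h h' : Fin n → ZMod 2} (hh : h ∈ shiftFlag C g y) (hh' : h' ∈ shiftFlag C g y) :
    (cyclicShift n ^ s) ((cyclicShift n ^ y) g + h) +
      (cyclicShift n ^ s') ((cyclicShift n ^ y) g + h') ∉ C := by
  intro hmem
  have h1 : (cyclicShift n ^ s') ((cyclicShift n ^ y) g + h') ∈ shiftFlag C g (y + s) :=
    shiftFlag_mono C g (by omega : y + 1 + s' ≤ y + s) (cyclicShift_pow_mem_shiftFlag hC
      (add_mem (pow_mem_shiftFlag_succ C g y) (shiftFlag_mono C g (Nat.le_succ y) hh')) s')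
  have h2 := shiftFlag_mono C g (Nat.zero_le (y + s)) hmem
  have h3 := (Submodule.add_mem_iff_left _ h1).1 h2
  rw [map_add] at h3
  have h4 := (Submodule.add_mem_iff_left _ (cyclicShift_pow_mem_shiftFlag hC hh s)).1 h3
  rw [← Module.End.mul_apply, ← pow_add, add_comm s y] at h4
  exact pow_notMem_shiftFlag hC hgen hs h4

end ShiftFlag

/-! ### Adapted bases and dual bases -/

/-- Greedy choice of independent vectors: the `i`-th vector can satisfy a condition `p i`, provided that
some vector satisfying it lies outside the span of any `i` vectors satisfying the earlier conditions. -/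
theorem exists_linearIndependent_of_greedy {K V : Type*} [Field K] [AddCommGroup V] [Module K V]
    (p : ℕ → V → Prop) (N : ℕ)
    (h : ∀ i < N, ∀ v : Fin i → V, (∀ j : Fin i, p j (v j)) →
      ∃ x, p i x ∧ x ∉ Submodule.span K (Set.range v)) :
    ∃ v : Fin N → V, LinearIndependent K v ∧ ∀ i : Fin N, p i (v i) := by
  induction N with
  | zero => exact ⟨Fin.elim0, linearIndependent_empty_type, fun i => i.elim0⟩
  | succ N ih =>
    obtain ⟨v, hv, hp⟩ := ih fun i hi => h i (by omega)
    obtain ⟨x, hx, hxs⟩ := h N (by omega) v hp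
    refine ⟨Fin.snoc v x, linearIndependent_finSnoc.2 ⟨hv, hxs⟩, fun i => ?_⟩
    induction i using Fin.lastCases with
    | last => simpa using hx
    | cast i => simpa using hp i

theorem exists_mem_notMem_span_of_lt_finrank {K V : Type*} [Field K] [AddCommGroup V] [Module K V]
    [FiniteDimensional K V] (W : Submodule K V) {i : ℕ} (hi : i < Module.finrank K W)
    (v : Fin i → V) : ∃ x ∈ W, x ∉ Submodule.span K (Set.range v) := by
  by_contra! h
  have h1 := Submodule.finrank_mono (show W ≤ Submodule.span K (Set.range v) from h)
  have h2 := finrank_range_le_card (R := K) v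
  rw [Fintype.card_fin] at h2
  exact absurd (h1.trans h2) (by omega)

/-- A basis of `(ZMod 2) ^ N` with a dual basis with respect to the dot product. -/
structure DualBases (N : ℕ) where
  e : Fin N → Fin N → ZMod 2
  f : Fin N → Fin N → ZMod 2
  dot : ∀ i j, dotProduct (e i) (f j) = if i = j then 1 else 0

theorem exists_dualBases {N : ℕ} (e : Fin N → Fin N → ZMod 2)
    (he : LinearIndependent (ZMod 2) e) : ∃ B : DualBases N, B.e = e := by
  have hu : IsUnit (Matrix.of e) := Matrix.linearIndependent_rows_iff_isUnit.1 he
  have hdet := (Matrix.isUnit_iff_isUnit_det _).1 hu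
  refine ⟨⟨e, fun j i => (Matrix.of e)⁻¹ i j, fun i j => ?_⟩, rfl⟩
  have := congrFun (congrFun (Matrix.mul_nonsing_inv _ hdet) i) j
  rwa [Matrix.one_apply] at this

namespace DualBases

variable {N : ℕ} (B : DualBases N)

theorem sum_e (x : Fin N → ZMod 2) : x = ∑ i, dotProduct x (B.f i) • B.e i := by
  have h : Matrix.of B.e * (Matrix.of B.f).transpose = 1 := by
    ext i j
    rw [Matrix.one_apply]
    exact B.dot i j
  have h' := mul_eq_one_comm.1 h
  have h2 := Matrix.vecMul_vecMul x (Matrix.of B.f).transpose (Matrix.of B.e)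
  rw [h', Matrix.vecMul_one, Matrix.vecMul_eq_sum] at h2
  exact h2.symm

theorem sum_f (z : Fin N → ZMod 2) : z = ∑ i, dotProduct z (B.e i) • B.f i :=
  sum_e ⟨B.f, B.e, fun i j => by rw [dotProduct_comm, B.dot]; simp only [eq_comm]⟩ z

end DualBases

/-- A basis in a prescribed order of positions: `p` vectors of `W₀` from position `k + y + δ` on, vectors of
`W₁` in the first `k` positions and in the `δ` positions from `k + y` on, and vectors of `W₂` in the `y`
positions from `k` on. The first vector is a given `x ∈ W₁ \ W₀`. For a flag `W₀ ≤ W₁ ≤ W₂` this is an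
adapted basis. -/
theorem exists_linearIndependent_adapted {K V : Type*} [Field K] [AddCommGroup V] [Module K V]
    [FiniteDimensional K V] {N k y δ p : ℕ} (hN : Module.finrank K V = N) (W₀ W₁ W₂ : Submodule K V)
    (h₀ : Module.finrank K W₀ = p) (h₁ : Module.finrank K W₁ = p + k + δ)
    (h₂ : Module.finrank K W₂ = p + k + δ + y) (hk : 0 < k) {x : V}
    (hx₁ : x ∈ W₁) (hx₀ : x ∉ W₀) :
    ∃ e : Fin N → V, LinearIndependent K e ∧
      (∀ i : Fin N, i.val = 0 → e i = x) ∧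
      (∀ i : Fin N, i.val < k → e i ∈ W₁) ∧
      (∀ i : Fin N, k ≤ i.val → i.val < k + y → e i ∈ W₂) ∧
      (∀ i : Fin N, k + y ≤ i.val → i.val < k + y + δ → e i ∈ W₁) ∧
      (∀ i : Fin N, k + y + δ ≤ i.val → i.val < k + y + δ + p → e i ∈ W₀) := by
  obtain ⟨v, hv, hp⟩ := exists_linearIndependent_of_greedy (K := K)
    (fun j z => (j < p → z ∈ W₀) ∧ (j = p → z = x) ∧ (p < j → j < p + k + δ → z ∈ W₁) ∧
      (p + k + δ ≤ j → j < p + k + δ + y → z ∈ W₂)) N (by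
    intro i hi v hv
    rcases lt_trichotomy i p with h | h | h
    · obtain ⟨z, hz, hzs⟩ := exists_mem_notMem_span_of_lt_finrank W₀ (h₀ ▸ h) v
      exact ⟨z, ⟨fun _ => hz, by omega, by omega, by omega⟩, hzs⟩
    · refine ⟨x, ⟨by omega, fun _ => rfl, by omega, by omega⟩, fun hxs => hx₀ ?_⟩
      refine (Submodule.span_le.2 ?_ : Submodule.span K (Set.range v) ≤ W₀) hxs
      rintro _ ⟨j, rfl⟩
      exact (hv j).1 (h ▸ j.isLt)
    · by_cases h' : i < p + k + δ
      · obtain ⟨z, hz, hzs⟩ := exists_mem_notMem_span_of_lt_finrank W₁ (h₁ ▸ h') v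
        exact ⟨z, ⟨by omega, by omega, fun _ _ => hz, by omega⟩, hzs⟩
      · by_cases h'' : i < p + k + δ + y
        · obtain ⟨z, hz, hzs⟩ := exists_mem_notMem_span_of_lt_finrank W₂ (h₂ ▸ h'') v
          exact ⟨z, ⟨by omega, by omega, by omega, fun _ _ => hz⟩, hzs⟩
        · obtain ⟨z, -, hzs⟩ := exists_mem_notMem_span_of_lt_finrank (⊤ : Submodule K V)
            (by rwa [finrank_top, hN]) v
          exact ⟨z, ⟨by omega, by omega, by omega, by omega⟩, hzs⟩)
  have hle : p + k + δ + y ≤ N := h₂ ▸ hN ▸ Submodule.finrank_le W₂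
  -- The greedy choice runs through `W₀`, `W₁`, `W₂` in turn; `φ` sends a position to its place in that order.
  let φ : Fin N → Fin N := fun i =>
    ⟨if i.val < k then i.val + p else if i.val < k + y then i.val + p + δ
      else if i.val < k + y + δ then i.val + p - y
      else if i.val < k + y + δ + p then i.val - (k + y + δ) else i.val, by
      have := i.isLt
      split_ifs <;> omega⟩
  have hφ : Function.Injective φ := by
    intro i j hij
    have := Fin.ext_iff.1 hij
    simp only [φ] at this
    ext
    split_ifs at this <;> omega
  have hφv : ∀ i, (φ i).val = if i.val < k then i.val + p else if i.val < k + y then i.val + p + δ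
      else if i.val < k + y + δ then i.val + p - y
      else if i.val < k + y + δ + p then i.val - (k + y + δ) else i.val := fun _ => rfl
  refine ⟨v ∘ φ, hv.comp φ hφ, ?_, ?_, ?_, ?_, ?_⟩
  · intro i hi
    exact (hp (φ i)).2.1 (by rw [hφv]; split_ifs <;> omega)
  · intro i hi
    have h := hφv i
    rw [if_pos hi] at h
    rcases Nat.eq_zero_or_pos i.val with h' | h'
    · rw [Function.comp_apply, (hp (φ i)).2.1 (by omega)]
      exact hx₁
    · exact (hp (φ i)).2.2.1 (by omega) (by omega)
  · intro i hi hi'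
    exact (hp (φ i)).2.2.2 (by rw [hφv]; split_ifs <;> omega) (by rw [hφv]; split_ifs <;> omega)
  · intro i hi hi'
    exact (hp (φ i)).2.2.1 (by rw [hφv]; split_ifs <;> omega) (by rw [hφv]; split_ifs <;> omega)
  · intro i hi hi'
    exact (hp (φ i)).1 (by rw [hφv]; split_ifs <;> omega)

/-! ### Periodic extension and folding -/

/-- The periodic extension of a word of length `n` to length `N`. -/
def periodicExtension (n N : ℕ) [NeZero n] : (Fin n → ZMod 2) →ₗ[ZMod 2] (Fin N → ZMod 2) :=
  LinearMap.funLeft (ZMod 2) (ZMod 2) fun j : Fin N => Fin.ofNat n j.val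

/-- Folding a word of length `N` modulo `n`, the transpose of `periodicExtension`. -/
def fold (n : ℕ) {N : ℕ} [NeZero n] (z : Fin N → ZMod 2) : Fin n → ZMod 2 :=
  fun i => ∑ j with Fin.ofNat n j.val = i, z j

section Periodic

variable {n N : ℕ} [NeZero n]

theorem periodicExtension_apply (u : Fin n → ZMod 2) (j : Fin N) :
    periodicExtension n N u j = u (Fin.ofNat n j.val) := rfl

theorem periodicExtension_add_apply (u : Fin n → ZMod 2) (s : ℕ) (i : Fin n) (h : s + i < N) :
    periodicExtension n N u ⟨s + i, h⟩ = (cyclicShift n ^ s) u i := by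
  rw [cyclicShift_pow_apply, finRotate_pow_apply]
  rfl

theorem periodicExtension_injective (h : n ≤ N) :
    Function.Injective (periodicExtension n N) := by
  intro u u' huu
  ext i
  have := congrFun huu ⟨0 + i, by omega⟩
  rw [periodicExtension_add_apply, periodicExtension_add_apply] at this
  simpa using this

theorem dotProduct_periodicExtension (z : Fin N → ZMod 2) (u : Fin n → ZMod 2) :
    dotProduct z (periodicExtension n N u) = dotProduct (fold n z) u := by
  simp only [dotProduct, fold, Finset.sum_mul]
  rw [← Finset.sum_fiberwise Finset.univ (fun j : Fin N => Fin.ofNat n j.val)]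
  refine Finset.sum_congr rfl fun i _ => Finset.sum_congr rfl fun j hj => ?_
  rw [periodicExtension_apply, (Finset.mem_filter.1 hj).2]

theorem hammingNorm_fold_le (z : Fin N → ZMod 2) : hammingNorm (fold n z) ≤ hammingNorm z := by
  refine le_trans (Finset.card_le_card fun i hi => ?_)
    (Finset.card_image_le (s := {j | z j ≠ 0}) (f := fun j : Fin N => Fin.ofNat n j.val))
  obtain ⟨j, hj, hj0⟩ := Finset.exists_ne_zero_of_sum_ne_zero (Finset.mem_filter.1 hi).2
  exact Finset.mem_image.2 ⟨j, by simpa using hj0, (Finset.mem_filter.1 hj).2⟩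

theorem hammingNorm_le_periodicExtension (h : n ≤ N) (u : Fin n → ZMod 2) :
    hammingNorm u ≤ hammingNorm (periodicExtension n N u) := by
  refine Finset.card_le_card_of_injOn (Fin.castLE h) (fun i hi => ?_)
    fun i _ j _ hij => Fin.castLE_injective h hij
  have hi' : u i ≠ 0 := by simpa using hi
  have : (Fin.ofNat n i.val : Fin n) = i := Fin.ext (Nat.mod_eq_of_lt i.isLt)
  refine Finset.mem_coe.2 (Finset.mem_filter.2 ⟨Finset.mem_univ _, ?_⟩)
  rwa [periodicExtension_apply, Fin.val_castLE, this]

end Periodic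

/-! ### Pauli operators -/

theorem half_zero : half 0 = 0 := rfl

theorem half_injective : Function.Injective half := by
  unfold Function.Injective
  decide

namespace Pauli

variable {n N : ℕ}

theorem commute_iff (P Q : Pauli n) :
    Commute P Q ↔ dotProduct P.z Q.x = dotProduct Q.z P.x := by
  rw [Commute, SemiconjBy, mul_def, mul_def, Pauli.mk.injEq]
  constructor
  · rintro ⟨h, -, -⟩
    refine half_injective ?_
    linear_combination h
  · intro h
    exact ⟨by rw [h]; ring, add_comm _ _, add_comm _ _⟩

theorem conj_eq (P Q : Pauli n) :
    Q⁻¹ * P * Q = ⟨P.phase + half (dotProduct P.z Q.x + dotProduct Q.z P.x), P.x, P.z⟩ := by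
  simp only [mul_def, inv_def, add_dotProduct, half_add]
  have h := half_add_self (dotProduct Q.z Q.x)
  ext1
  · linear_combination h
  · exact word_add_add_self _ _
  · exact word_add_add_self _ _

theorem sign_mul (a : ZMod 2) (P : Pauli n) : sign a * P = ⟨half a + P.phase, P.x, P.z⟩ := by
  simp [sign, mul_def, half_zero]

theorem place_one (N s : ℕ) : place N s (1 : Pauli n) = 1 := by
  simp [place, one_def, Pi.zero_def]

theorem place_x_apply (P : Pauli n) {s : ℕ} (hs : s + n ≤ N) (i : Fin n) :
    (place N s P).x ⟨s + i, by omega⟩ = P.x i := by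
  simp [place]

theorem place_z_apply (P : Pauli n) {s : ℕ} (hs : s + n ≤ N) (i : Fin n) :
    (place N s P).z ⟨s + i, by omega⟩ = P.z i := by
  simp [place]

/-- Only the window contributes to a dot product with the `Z`-part of a placed operator. -/
theorem dotProduct_place_z (P : Pauli n) {s : ℕ} (hs : s + n ≤ N) (v : Fin N → ZMod 2) :
    dotProduct (place N s P).z v = dotProduct P.z fun i : Fin n => v ⟨s + i, by omega⟩ := by
  have hinj : Function.Injective fun i : Fin n => (⟨s + i, by omega⟩ : Fin N) := by
    intro i j hij
    ext
    simpa using hij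
  refine (Fintype.sum_of_injective _ hinj _ _ (fun j hj => ?_) fun i => ?_).symm
  · have h : ¬(s ≤ j.val ∧ j.val - s < n) := fun h =>
      hj ⟨⟨j.val - s, h.2⟩, Fin.ext (by simp; omega)⟩
    simp [place, h]
  · rw [place_z_apply P hs]

theorem weight_place_le (P : Pauli n) {s : ℕ} (hs : s + n ≤ N) :
    (place N s P).weight ≤ P.weight := by
  refine le_trans (Finset.card_le_card fun j hj => ?_)
    (Finset.card_image_le (s := {i | P.x i ≠ 0 ∨ P.z i ≠ 0})
      (f := fun i : Fin n => (⟨s + i, by omega⟩ : Fin N)))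
  have hj' := (Finset.mem_filter.1 hj).2
  by_cases h : s ≤ j.val ∧ j.val - s < n
  · refine Finset.mem_image.2 ⟨⟨j.val - s, h.2⟩, ?_, Fin.ext (by simp; omega)⟩
    simpa [place, h] using hj'
  · simp [place, h] at hj'

theorem hammingNorm_x_le_weight (P : Pauli n) : hammingNorm P.x ≤ P.weight :=
  Finset.card_le_card (Finset.monotone_filter_right _ fun _ _ => Or.inl)

theorem hammingNorm_z_le_weight (P : Pauli n) : hammingNorm P.z ≤ P.weight :=
  Finset.card_le_card (Finset.monotone_filter_right _ fun _ _ => Or.inr)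

/-- The words `z` for which the group `G` contains the operator `Z(z)` with sign `(-1) ^ (z · v)`. -/
def zWords (G : Subgroup (Pauli N)) (v : Fin N → ZMod 2) :
    Submodule (ZMod 2) (Fin N → ZMod 2) where
  carrier := {z | (⟨half (dotProduct z v), 0, z⟩ : Pauli N) ∈ G}
  zero_mem' := by
    rw [Set.mem_ofPred_eq, zero_dotProduct]
    exact G.one_mem
  add_mem' := by
    intro z z' hz hz'
    simpa [mul_def, half_zero, half_add, add_dotProduct] using G.mul_mem hz hz'
  smul_mem' := by
    intro a z hz
    rcases zmod_two_eq_zero_or_one a with rfl | rfl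
    · rw [Set.mem_ofPred_eq, zero_smul, zero_dotProduct]
      exact G.one_mem
    · rwa [one_smul]

theorem mem_zWords {G : Subgroup (Pauli N)} {v z : Fin N → ZMod 2} :
    z ∈ zWords G v ↔ (⟨half (dotProduct z v), 0, z⟩ : Pauli N) ∈ G := Iff.rfl

/-- The operators whose `Z`-part is orthogonal to `v`. -/
def zOrthogonal (v : Fin N → ZMod 2) : Subgroup (Pauli N) where
  carrier := {P | dotProduct P.z v = 0}
  one_mem' := zero_dotProduct v
  mul_mem' := by
    intro P Q hP hQ
    exact (add_dotProduct P.z Q.z v).trans (by rw [hP, hQ, add_zero])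
  inv_mem' := fun {P} hP => hP

theorem mem_zOrthogonal {v : Fin N → ZMod 2} {P : Pauli N} :
    P ∈ zOrthogonal v ↔ dotProduct P.z v = 0 := Iff.rfl

/-- The operators `X(x) Z(z)`, with sign `+`, for `x ∈ A` and `z` in the dual of `A`. -/
def cssGroup (A : Submodule (ZMod 2) (Fin N → ZMod 2)) : Subgroup (Pauli N) where
  carrier := {P | P.phase = 0 ∧ P.x ∈ A ∧ P.z ∈ dualCode A}
  one_mem' := ⟨rfl, A.zero_mem, (dualCode A).zero_mem⟩
  mul_mem' := by
    rintro P Q ⟨hP, hPx, hPz⟩ ⟨hQ, hQx, hQz⟩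
    refine ⟨?_, A.add_mem hPx hQx, (dualCode A).add_mem hPz hQz⟩
    rw [mul_def, dotProduct_comm, hPz _ hQx, hP, hQ]
    rfl
  inv_mem' := by
    rintro P ⟨hP, hPx, hPz⟩
    refine ⟨?_, hPx, hPz⟩
    rw [inv_def, dotProduct_comm, hPz _ hPx, hP]
    rfl

theorem mem_cssGroup {A : Submodule (ZMod 2) (Fin N → ZMod 2)} {P : Pauli N} :
    P ∈ cssGroup A ↔ P.phase = 0 ∧ P.x ∈ A ∧ P.z ∈ dualCode A := Iff.rfl

/-- Measuring `Z(w)` on the window that starts at `s`: an error `E` adds `w · E.x` to the outcome. -/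
theorem yields_z_iff {S : Subgroup (Pauli N)} {s : ℕ} (hs : s + n ≤ N) (E : Pauli n)
    (w : Fin n → ZMod 2) (a : ZMod 2) :
    Yields S s E ⟨0, 0, w⟩ a ↔
      (⟨half (a + dotProduct w E.x), 0, (place N s ⟨0, 0, w⟩).z⟩ : Pauli N) ∈ S := by
  have hx : (place N s (⟨0, 0, w⟩ : Pauli n)).x = 0 := by
    ext j
    simp [place]
  rw [Yields, conj_eq, sign_mul]
  simp only [hx, dotProduct_zero, add_zero, half_add, dotProduct_place_z _ hs (place N s E).x,
    place_x_apply _ hs]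
  exact Iff.of_eq (congrArg (· ∈ S) (by ext1 <;> simp [place]))

end Pauli

/-! ### Hybrid subsystem codes of CSS type -/

/-- The hybrid subsystem code given by dual bases `e`, `f`: for `τ i` the virtual operators `Z i`, `X i` are
`X(e i)`, `Z(f i)`, otherwise they are `(-1) ^ (f i · v) Z(f i)`, `X(e i)`. The signs amount to translating
the code words by `v`. -/
def cssCode {N k m r : ℕ} (B : DualBases N) (τ : Fin N → Prop) [DecidablePred τ]
    (v : Fin N → ZMod 2) (h : k + m + r ≤ N) : HybridSubsystemCode N k m r where
  X i := if τ i then ⟨0, 0, B.f i⟩ else ⟨0, B.e i, 0⟩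
  Z i := if τ i then ⟨0, B.e i, 0⟩ else ⟨half (dotProduct (B.f i) v), 0, B.f i⟩
  size_le := h
  X_mul_self i := by
    split_ifs <;> simp [Pauli.mul_def, Pauli.one_def, half_zero, word_add_self]
  Z_mul_self i := by
    split_ifs <;> simp [Pauli.mul_def, Pauli.one_def, half_zero, half_add_self, word_add_self]
  X_comm i j := by
    rw [Pauli.commute_iff]
    split_ifs with h1 h2 h2
    · simp
    · have hij : j ≠ i := by rintro rfl; exact h2 h1
      simp [dotProduct_comm (B.f i), B.dot, hij]
    · have hij : i ≠ j := by rintro rfl; exact h1 h2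
      simp [dotProduct_comm (B.f j), B.dot, hij]
    · simp
  Z_comm i j := by
    rw [Pauli.commute_iff]
    split_ifs with h1 h2 h2
    · simp
    · have hij : i ≠ j := by rintro rfl; exact h2 h1
      simp [dotProduct_comm (B.f j), B.dot, hij]
    · have hij : j ≠ i := by rintro rfl; exact h1 h2
      simp [dotProduct_comm (B.f i), B.dot, hij]
    · simp
  XZ_comm i j hij := by
    rw [Pauli.commute_iff]
    split_ifs
    · simp [dotProduct_comm (B.f i), B.dot, hij.symm]
    · simp
    · simp
    · simp [dotProduct_comm (B.f j), B.dot, hij]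
  XZ_anticomm i := by
    rw [Pauli.sign_mul]
    split_ifs
    · simp [Pauli.mul_def, dotProduct_comm (B.f i), B.dot, half_zero]
    · have h1 := half_add_self 1
      simp only [Pauli.mul_def, dotProduct_comm (B.f i), B.dot, zero_dotProduct, if_true, half_zero]
      ext1
      · linear_combination -h1
      · simp
      · simp

theorem DualBases.mem_zWords {N : ℕ} (B : DualBases N) {G : Subgroup (Pauli N)}
    {u z : Fin N → ZMod 2} (h : ∀ i, dotProduct z (B.e i) = 0 ∨ B.f i ∈ Pauli.zWords G u) :
    z ∈ Pauli.zWords G u := by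
  rw [B.sum_f z]
  refine Submodule.sum_mem _ fun i _ => ?_
  rcases h i with h | h
  · simp [h]
  · exact Submodule.smul_mem _ _ h

namespace HybridSubsystemCode

variable {N k m r : ℕ}

theorem mem_centralizer_outerStabilizer {Q : HybridSubsystemCode N k m r} {P : Pauli N} :
    P ∈ Subgroup.centralizer (Q.outerStabilizer : Set (Pauli N)) ↔
      ∀ i : Fin N, k + m + r ≤ i.val → Commute (Q.Z i) P := by
  rw [outerStabilizer, Subgroup.centralizer_closure, Subgroup.mem_centralizer_iff]
  constructor
  · exact fun h i hi => h _ ⟨i, hi, rfl⟩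
  · rintro h _ ⟨i, hi, rfl⟩
    exact h i hi

theorem Z_mem_innerGaugeGroup (Q : HybridSubsystemCode N k m r) {i : Fin N} (hi : k + m ≤ i.val) :
    Q.Z i ∈ Q.innerGaugeGroup :=
  Subgroup.mem_sup_left (Subgroup.subset_closure (Or.inl (Or.inr ⟨i, hi, rfl⟩)))

theorem scalar_mem_innerGaugeGroup (Q : HybridSubsystemCode N k m r) (p : ZMod 4) :
    (⟨p, 0, 0⟩ : Pauli N) ∈ Q.innerGaugeGroup := by
  have himag : (Pauli.imag : Pauli N) ∈ Q.innerGaugeGroup :=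
    Subgroup.mem_sup_left (Subgroup.subset_closure (Or.inl (Or.inl rfl)))
  have h : ∀ j : ℕ, (⟨j, 0, 0⟩ : Pauli N) ∈ Q.innerGaugeGroup := by
    intro j
    induction j with
    | zero => exact Nat.cast_zero (R := ZMod 4) ▸ Q.innerGaugeGroup.one_mem
    | succ j ih => simpa [Pauli.imag, Pauli.mul_def, half_zero] using mul_mem ih himag
  simpa using h p.val

theorem innerGaugeGroup_le {Q : HybridSubsystemCode N k m r} {H : Subgroup (Pauli N)}
    (himag : Pauli.imag ∈ H) (hZ : ∀ i : Fin N, k ≤ i.val → Q.Z i ∈ H)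
    (hX : ∀ i : Fin N, k ≤ i.val → Q.X i ∈ H) : Q.innerGaugeGroup ≤ H := by
  refine sup_le ((Subgroup.closure_le _).2 ?_) ((Subgroup.closure_le _).2 ?_)
  · rintro _ ((rfl | ⟨i, hi, rfl⟩) | ⟨i, hi, -, rfl⟩)
    · exact himag
    · exact hZ i (by omega)
    · exact hX i (by omega)
  · rintro _ ⟨i, hi, -, rfl⟩
    exact hZ i hi

theorem syncDistance_eq {Q : HybridSubsystemCode N k m r} {n al ar t : ℕ}
    (h : Q.CorrectsMisalignment n al al ar t) : Q.syncDistance n al ar t = al + ar + 1 := by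
  refine IsGreatest.csSup_eq ⟨⟨al, ar, le_rfl, le_rfl, h, rfl⟩, ?_⟩
  rintro _ ⟨bl, br, hl, hr, -, rfl⟩
  omega

/-- No misalignment leaves a single window position, which needs no measurement. -/
theorem syncDistance_zero_zero (Q : HybridSubsystemCode N k m r) (n t : ℕ) :
    Q.syncDistance n 0 0 t = 1 :=
  syncDistance_eq ⟨∅, by simp, fun s s' _ _ _ _ _ => by omega⟩

/-- If the message `0` has a stabilizer group of operators with the fixed sign `+`, then so have two
blocks, and a measurement that is determined both on the aligned and on a shifted window has the same
outcome on both. -/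
theorem nonSynchronizable_of_le_cssGroup {Q : HybridSubsystemCode N k m r}
    {A : Submodule (ZMod 2) (Fin N → ZMod 2)} (h : Q.messageStabilizer 0 ≤ Pauli.cssGroup A) :
    Q.NonSynchronizable := by
  rintro s - - ⟨M, -, hM⟩
  obtain ⟨P, -, a, a', haa, h1, h2⟩ := hM 0 0 0 0
  let left : Fin N → Fin (N + N) := fun i => ⟨0 + i, by omega⟩
  let right : Fin N → Fin (N + N) := fun i => ⟨N + i, by omega⟩
  let A2 : Submodule (ZMod 2) (Fin (N + N) → ZMod 2) :=
    A.comap (LinearMap.funLeft (ZMod 2) (ZMod 2) left) ⊓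
      A.comap (LinearMap.funLeft (ZMod 2) (ZMod 2) right)
  have hle : Q.twoBlockStabilizer 0 0 ≤ Pauli.cssGroup A2 := by
    refine (Subgroup.closure_le _).2 ?_
    rintro _ (⟨R, hR, rfl⟩ | ⟨R, hR, rfl⟩)
    · obtain ⟨hp, hx, hz⟩ := h hR
      have h1 : LinearMap.funLeft (ZMod 2) (ZMod 2) left (Pauli.place (N + N) 0 R).x = R.x :=
        funext fun i => Pauli.place_x_apply R (by omega) i
      have h2 : LinearMap.funLeft (ZMod 2) (ZMod 2) right (Pauli.place (N + N) 0 R).x = 0 := by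
        ext i
        simp [LinearMap.funLeft_apply, Pauli.place, right]
      refine ⟨hp, ⟨Submodule.mem_comap.2 (h1 ▸ hx), Submodule.mem_comap.2 (h2 ▸ A.zero_mem)⟩,
        fun c hc => ?_⟩
      rw [dotProduct_comm, Pauli.dotProduct_place_z R (by omega), dotProduct_comm]
      exact hz _ hc.1
    · obtain ⟨hp, hx, hz⟩ := h hR
      have h1 : LinearMap.funLeft (ZMod 2) (ZMod 2) left (Pauli.place (N + N) N R).x = 0 := by
        ext i
        simp [LinearMap.funLeft_apply, Pauli.place, left]
      have h2 : LinearMap.funLeft (ZMod 2) (ZMod 2) right (Pauli.place (N + N) N R).x = R.x :=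
        funext fun i => Pauli.place_x_apply R (by omega) i
      refine ⟨hp, ⟨Submodule.mem_comap.2 (h1 ▸ A.zero_mem), Submodule.mem_comap.2 (h2 ▸ hx)⟩,
        fun c hc => ?_⟩
      rw [dotProduct_comm, Pauli.dotProduct_place_z R le_rfl, dotProduct_comm]
      exact hz _ hc.2
  have key : ∀ {s a}, Pauli.Yields (Q.twoBlockStabilizer 0 0) s 1 P a → half a + P.phase = 0 := by
    intro s a h
    have := (Pauli.mem_cssGroup.1 (hle h)).1
    rwa [Pauli.place_one, inv_one, one_mul, mul_one, Pauli.sign_mul] at this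
  exact haa (half_injective (add_right_cancel ((key h1).trans (key h2).symm)))

end HybridSubsystemCode

section CSSCode

open HybridSubsystemCode

variable {N k m r : ℕ} {B : DualBases N} {τ : Fin N → Prop} [DecidablePred τ]
  {v : Fin N → ZMod 2} {h : k + m + r ≤ N}

theorem cssCode_Z_of_pos {i : Fin N} (hi : τ i) : (cssCode B τ v h).Z i = ⟨0, B.e i, 0⟩ :=
  if_pos hi

theorem cssCode_Z_of_neg {i : Fin N} (hi : ¬τ i) :
    (cssCode B τ v h).Z i = ⟨half (dotProduct (B.f i) v), 0, B.f i⟩ :=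
  if_neg hi

theorem mem_centralizer_cssCode {P : Pauli N} :
    P ∈ Subgroup.centralizer ((cssCode B τ v h).outerStabilizer : Set (Pauli N)) ↔
      ∀ i : Fin N, k + m + r ≤ i.val →
        (τ i → dotProduct P.z (B.e i) = 0) ∧ (¬τ i → dotProduct P.x (B.f i) = 0) := by
  rw [mem_centralizer_outerStabilizer]
  refine forall₂_congr fun i _ => ?_
  rw [Pauli.commute_iff]
  by_cases hi : τ i
  · simp [cssCode_Z_of_pos hi, hi, eq_comm]
  · simp [cssCode_Z_of_neg hi, hi, dotProduct_comm P.x]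

/-- The `Z`-parts of the inner gauge group are orthogonal to the vectors `e i` of the logical qubits. -/
theorem innerGaugeGroup_cssCode_le {i₀ : Fin N} (hi₀ : i₀.val < k) :
    (cssCode B τ v h).innerGaugeGroup ≤ Pauli.zOrthogonal (B.e i₀) := by
  have hf : ∀ i : Fin N, k ≤ i.val → dotProduct (B.f i) (B.e i₀) = 0 := by
    intro i hi
    rw [dotProduct_comm, B.dot, if_neg]
    rintro rfl
    omega
  refine innerGaugeGroup_le (zero_dotProduct _) (fun i hi => ?_) fun i hi => ?_
  · rw [Pauli.mem_zOrthogonal]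
    simp only [cssCode]
    split_ifs
    · exact zero_dotProduct _
    · exact hf i hi
  · rw [Pauli.mem_zOrthogonal]
    simp only [cssCode]
    split_ifs
    · exact hf i hi
    · exact zero_dotProduct _

theorem nonSynchronizable_cssCode : (cssCode B τ 0 h).NonSynchronizable := by
  refine nonSynchronizable_of_le_cssGroup
    (A := Submodule.span (ZMod 2) {x | ∃ i, τ i ∧ x = B.e i}) ((Subgroup.closure_le _).2 ?_)
  have hZ : ∀ i, (cssCode B τ 0 h).Z i ∈
      Pauli.cssGroup (Submodule.span (ZMod 2) {x | ∃ i, τ i ∧ x = B.e i}) := by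
    intro i
    by_cases hi : τ i
    · rw [cssCode_Z_of_pos hi]
      exact ⟨rfl, Submodule.subset_span ⟨i, hi, rfl⟩, Submodule.zero_mem _⟩
    · rw [cssCode_Z_of_neg hi, dotProduct_zero]
      refine ⟨rfl, Submodule.zero_mem _, fun c hc => ?_⟩
      induction hc using Submodule.span_induction with
      | mem x hx =>
        obtain ⟨j, hj, rfl⟩ := hx
        rw [B.dot, if_neg]
        rintro rfl
        exact hi hj
      | zero => exact zero_dotProduct _
      | add x y _ _ hx hy => rw [add_dotProduct, hx, hy, add_zero]
      | smul a x _ hx => rw [smul_dotProduct, hx, smul_zero]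
  rintro _ (⟨j, rfl⟩ | ⟨i, -, rfl⟩)
  · have : Pauli.sign ((0 : Fin m → ZMod 2) j) = (1 : Pauli N) := rfl
    rw [this, one_mul]
    exact hZ _
  · exact hZ i

variable {n : ℕ} [NeZero n] {C D : Submodule (ZMod 2) (Fin n → ZMod 2)}

/-- An operator in the centralizer of the stabilizer has an `X`-part that extends a word of `D` and a
`Z`-part that folds to a word of `D`. If one of these words is nonzero, it bounds the weight; if both
vanish, the operator is a scalar multiple of a stabilizer. -/
theorem le_weight_cssCode (hn : n ≤ N) {kd dd : ℕ} (hD : IsLinearCode D kd dd)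
    (hED : ∀ i : Fin N, (k + m + r ≤ i.val ∧ ¬τ i) ∨ B.e i ∈ D.map (periodicExtension n N))
    (hspan : (dualCode D).map (periodicExtension n N) ≤
      Submodule.span (ZMod 2) {x | ∃ i : Fin N, (k + m + r ≤ i.val ∧ τ i) ∧ x = B.e i})
    {P : Pauli N}
    (hP : P ∈ Subgroup.centralizer ((cssCode B τ v h).outerStabilizer : Set (Pauli N)))
    (hP' : P ∉ (cssCode B τ v h).innerGaugeGroup) : dd ≤ P.weight := by
  rw [mem_centralizer_cssCode] at hP
  have hx : P.x ∈ D.map (periodicExtension n N) := by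
    rw [B.sum_e P.x]
    refine Submodule.sum_mem _ fun i _ => ?_
    rcases hED i with hi | hi
    · rw [(hP i hi.1).2 hi.2, zero_smul]
      exact Submodule.zero_mem _
    · exact Submodule.smul_mem _ _ hi
  have hz : fold n P.z ∈ D := by
    rw [← dualCode_dualCode D]
    intro w hw
    rw [dotProduct_comm, ← dotProduct_periodicExtension]
    have hw' := hspan (Submodule.mem_map_of_mem hw)
    generalize periodicExtension n N w = x at hw' ⊢
    induction hw' using Submodule.span_induction with
    | mem x hx =>
      obtain ⟨i, hi, rfl⟩ := hx
      exact (hP i hi.1).1 hi.2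
    | zero => exact dotProduct_zero _
    | add x y _ _ hx hy => rw [dotProduct_add, hx, hy, add_zero]
    | smul a x _ hx => rw [dotProduct_smul, hx, smul_zero]
  obtain ⟨u, hu, hux⟩ := hx
  by_cases hu0 : u = 0
  · by_cases hz0 : fold n P.z = 0
    · -- The `Z`-part is then orthogonal to all periodic words, in particular to the extension of `D`.
      refine absurd ?_ hP'
      have hzw : P.z ∈ Pauli.zWords (cssCode B τ v h).innerGaugeGroup v := by
        refine B.mem_zWords fun i => ?_
        rcases hED i with hi | ⟨c, -, hc⟩
        · refine Or.inr ?_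
          rw [Pauli.mem_zWords, ← cssCode_Z_of_neg (h := h) hi.2]
          exact Z_mem_innerGaugeGroup _ (by omega)
        · left
          rw [← hc, dotProduct_periodicExtension, hz0, zero_dotProduct]
      have hmul := mul_mem (scalar_mem_innerGaugeGroup (cssCode B τ v h)
        (P.phase - half (dotProduct P.z v))) (Pauli.mem_zWords.1 hzw)
      convert hmul using 1
      rw [hu0, map_zero] at hux
      ext1
      · simp [Pauli.mul_def, half_zero]
      · simp [Pauli.mul_def, ← hux]
      · simp [Pauli.mul_def]
    · exact (hD.2.2 ⟨_, hz, hz0, rfl⟩).trans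
        ((hammingNorm_fold_le _).trans P.hammingNorm_z_le_weight)
  · refine (hD.2.2 ⟨u, hu, hu0, rfl⟩).trans
      ((hammingNorm_le_periodicExtension hn u).trans ?_)
    rw [hux]
    exact P.hammingNorm_x_le_weight

theorem hasDesignDistance_cssCode (hn : n ≤ N) {kd dd : ℕ} (hD : IsLinearCode D kd dd)
    (hED : ∀ i : Fin N, (k + m + r ≤ i.val ∧ ¬τ i) ∨ B.e i ∈ D.map (periodicExtension n N))
    (hE : ∀ i : Fin N, k + m + r ≤ i.val → τ i → B.e i ∈ (dualCode D).map (periodicExtension n N))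
    (hspan : (dualCode D).map (periodicExtension n N) ≤
      Submodule.span (ZMod 2) {x | ∃ i : Fin N, (k + m + r ≤ i.val ∧ τ i) ∧ x = B.e i})
    {i₀ : Fin N} (hi₀ : i₀.val < k) {u : Fin n → ZMod 2} (hu : B.e i₀ = periodicExtension n N u)
    (huc : (∃ c ∈ D, c ∉ dualCode C ∧ hammingNorm c = dd) →
      ∃ c ∈ D, dotProduct c u = 1 ∧ hammingNorm c = dd) :
    HasDesignDistance C D dd (cssCode B τ v h) := by
  have hle : dd ≤ (cssCode B τ v h).minDistance := by
    refine le_csInf ⟨_, ⟨0, 0, B.f i₀⟩, mem_centralizer_cssCode.2 fun i hi => ⟨fun _ => ?_, fun _ =>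
      zero_dotProduct _⟩, fun hG => ?_, rfl⟩ ?_
    · rw [dotProduct_comm, B.dot, if_neg]
      rintro rfl
      omega
    · have := innerGaugeGroup_cssCode_le hi₀ hG
      rw [Pauli.mem_zOrthogonal, dotProduct_comm, B.dot, if_pos rfl] at this
      exact one_ne_zero this
    · rintro _ ⟨P, hP, hP', rfl⟩
      exact le_weight_cssCode hn hD hED hspan hP hP'
  refine ⟨hle, fun hc => le_antisymm ?_ hle⟩
  obtain ⟨c, hcD, hcu, rfl⟩ := huc hc
  have hdot : ∀ w : Fin n → ZMod 2,
      dotProduct (Pauli.place N 0 ⟨0, 0, c⟩).z (periodicExtension n N w) = dotProduct c w := by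
    intro w
    rw [Pauli.dotProduct_place_z _ (by omega)]
    simp only [periodicExtension_add_apply]
    rfl
  have hwt : (⟨0, 0, c⟩ : Pauli n).weight ≤ hammingNorm c :=
    Finset.card_le_card (Finset.monotone_filter_right _ fun i _ => by simp)
  refine le_trans (Nat.sInf_le ⟨Pauli.place N 0 ⟨0, 0, c⟩, mem_centralizer_cssCode.2 fun i hi =>
    ⟨fun hi' => ?_, fun _ => ?_⟩, fun hG => ?_, rfl⟩)
    ((Pauli.weight_place_le ⟨0, 0, c⟩ (by omega : 0 + n ≤ N)).trans hwt)
  · obtain ⟨w, hw, hwe⟩ := hE i hi hi'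
    rw [← hwe, hdot]
    exact hw c hcD
  · have : (Pauli.place N 0 (⟨0, 0, c⟩ : Pauli n)).x = 0 := by
      ext j
      simp [Pauli.place]
    rw [this, zero_dotProduct]
  · have := innerGaugeGroup_cssCode_le hi₀ hG
    rw [Pauli.mem_zOrthogonal, hu, hdot, hcu] at this
    exact one_ne_zero this

/-- The parity checks of `C` on the window are determined for every message; they read off the coset of
`T ^ s (g + h) + E.x` modulo `C`. Modulo `D` this is the coset of the error `E.x`, which is thereby
identified, and the separation hypothesis then identifies the position `s`. -/
theorem correctsMisalignment_cssCode {al ar y t kd dd : ℕ} (hN : N = n + al + ar) (hym : y ≤ m)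
    (hC : IsCyclicCode C) (hD : IsCyclicCode D) (hDd : IsLinearCode D kd dd) (ht : 2 * t < dd)
    (hCD : C ≤ D) {H : Submodule (ZMod 2) (Fin n → ZMod 2)} (hH : H ≤ D) {g : Fin n → ZMod 2}
    (hg : g ∈ D) (hv : v = periodicExtension n N g)
    (hEC : ∀ i : Fin N, B.e i ∈ C.map (periodicExtension n N) ∨
      (¬τ i ∧ (k + m + r ≤ i.val ∨ (k ≤ i.val ∧ i.val < k + y))))
    (hEH : ∀ i : Fin N, k ≤ i.val → i.val < k + y → B.e i ∈ H.map (periodicExtension n N))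
    (hsep : ∀ s s', s' < s → s ≤ al + ar → ∀ h ∈ H, ∀ h' ∈ H,
      (cyclicShift n ^ s) (g + h) + (cyclicShift n ^ s') (g + h') ∉ C) :
    (cssCode B τ v h).CorrectsMisalignment n al al ar t := by
  -- The message `b` translates the code words by the periodic extension of a word of `H`.
  have hmsg : ∀ b : Fin m → ZMod 2, ∃ h' ∈ H, ∀ w ∈ dualCode C, ∀ s ≤ al + ar, ∀ E : Pauli n,
      Pauli.Yields ((cssCode B τ v h).messageStabilizer b) s E ⟨0, 0, w⟩
        (dotProduct w ((cyclicShift n ^ s) (g + h') + E.x)) := by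
    intro b
    have hbm : ∑ j : Fin y, b ⟨j, by omega⟩ • B.e ⟨k + j, by omega⟩ ∈
        H.map (periodicExtension n N) :=
      Submodule.sum_mem _ fun j _ => Submodule.smul_mem _ _
        (hEH _ (Nat.le_add_right _ _) (Nat.add_lt_add_left j.isLt k))
    obtain ⟨h', hh', hhe⟩ := hbm
    refine ⟨h', hh', fun w hw s hs E => ?_⟩
    have hsN : s + n ≤ N := by omega
    have hdot : ∀ u : Fin n → ZMod 2, dotProduct (Pauli.place N s ⟨0, 0, w⟩).z
        (periodicExtension n N u) = dotProduct w ((cyclicShift n ^ s) u) := by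
      intro u
      rw [Pauli.dotProduct_place_z _ hsN]
      simp only [periodicExtension_add_apply]
    rw [Pauli.yields_z_iff hsN, dotProduct_add, add_assoc, CharTwo.add_self_eq_zero, add_zero,
      ← hdot, ← Pauli.mem_zWords]
    refine B.mem_zWords fun i => ?_
    rcases hEC i with ⟨c, hc, hci⟩ | ⟨hiτ, hi⟩
    · left
      rw [← hci, hdot, dotProduct_comm]
      exact hw _ (hC.cyclicShift_pow_mem hc s)
    · right
      rw [Pauli.mem_zWords, map_add, hhe, ← hv, dotProduct_add, dotProduct_sum]
      have hterm : ∀ j : Fin y, dotProduct (B.f i) (b ⟨j, by omega⟩ • B.e ⟨k + j, by omega⟩) =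
          if i.val = k + j then b ⟨j, by omega⟩ else 0 := by
        intro j
        rw [dotProduct_smul, dotProduct_comm, B.dot, smul_eq_mul, mul_ite, mul_one, mul_zero]
        simp only [Fin.ext_iff, eq_comm]
      simp only [hterm]
      rcases hi with hi | ⟨hki, hiy⟩
      · rw [Finset.sum_eq_zero fun j _ => if_neg (by omega), add_zero, ← cssCode_Z_of_neg (h := h) hiτ]
        exact Subgroup.subset_closure (Or.inr ⟨i, hi, rfl⟩)
      · rw [Finset.sum_eq_single (⟨i.val - k, by omega⟩ : Fin y)
          (fun j _ hj => if_neg fun hij => hj (Fin.ext (by simp; omega))) (by simp),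
          if_pos (by simp; omega)]
        refine Subgroup.subset_closure (Or.inl ⟨⟨i.val - k, by omega⟩, ?_⟩)
        have hidx : (⟨k + (i.val - k), by omega⟩ : Fin N) = i := Fin.ext (by simp; omega)
        simp only [hidx]
        rw [cssCode_Z_of_neg hiτ, Pauli.sign_mul, half_add, add_comm]
  have hgH : ∀ h' ∈ H, ∀ s, (cyclicShift n ^ s) (g + h') ∈ D := fun h' hh' s =>
    hD.cyclicShift_pow_mem (D.add_mem hg (hH hh')) s
  refine ⟨{P | ∃ w ∈ dualCode C, P = ⟨0, 0, w⟩}, ?_, ?_⟩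
  · rintro _ ⟨w, hw, rfl⟩ s - hs b E -
    obtain ⟨h', -, hy⟩ := hmsg b
    exact ⟨_, hy w hw s hs E⟩
  · intro s s' _ hs _ hs' hss b b' E E' hE hE'
    obtain ⟨h₁, hh₁, hy₁⟩ := hmsg b
    obtain ⟨h₂, hh₂, hy₂⟩ := hmsg b'
    have hq : ((cyclicShift n ^ s) (g + h₁) + E.x) + ((cyclicShift n ^ s') (g + h₂) + E'.x) ∉ C := by
      intro hq
      rw [add_add_add_comm] at hq
      have hEE : E.x + E'.x ∈ D :=
        (D.add_mem_iff_right (D.add_mem (hgH h₁ hh₁ s) (hgH h₂ hh₂ s'))).1 (hCD hq)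
      have hEE0 : E.x + E'.x = 0 := by
        by_contra hne
        have h1 := hDd.2.2 ⟨_, hEE, hne, rfl⟩
        have h2 : hammingNorm (E.x + E'.x) ≤ hammingNorm E.x + hammingNorm E'.x := by
          have := hammingDist_triangle E.x 0 E'.x
          rwa [hammingDist_zero_right, hammingDist_zero_left, hammingDist_eq_hammingNorm,
            CharTwo.neg_eq] at this
        have h3 := E.hammingNorm_x_le_weight
        have h4 := E'.hammingNorm_x_le_weight
        omega
      rw [hEE0, add_zero] at hq
      rcases lt_or_gt_of_ne hss with hlt | hlt
      · exact hsep s' s hlt hs' h₂ hh₂ h₁ hh₁ (by rwa [add_comm] at hq)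
      · exact hsep s s' hlt hs h₁ hh₁ h₂ hh₂ hq
    obtain ⟨w, hw, hwq⟩ := exists_mem_dualCode_dotProduct_eq_one hq
    refine ⟨_, ⟨w, hw, rfl⟩, _, _, fun heq => ?_, hy₁ w hw s hs E, hy₂ w hw s' hs' E'⟩
    rw [dotProduct_add, heq, CharTwo.add_self_eq_zero] at hwq
    exact zero_ne_one hwq

end CSSCode

/-! ### The codes obtained from a pair of cyclic codes -/

theorem exists_mem_notMem_dualCode {n dd : ℕ} {C D : Submodule (ZMod 2) (Fin n → ZMod 2)}
    (hdual : dualCode C < C) (hCD : C ≤ D) :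
    ∃ u ∈ C, u ∉ dualCode D ∧ ((∃ c ∈ D, c ∉ dualCode C ∧ hammingNorm c = dd) →
      ∃ c ∈ D, dotProduct c u = 1 ∧ hammingNorm c = dd) := by
  by_cases h : ∃ c ∈ D, c ∉ dualCode C ∧ hammingNorm c = dd
  · obtain ⟨c, hcD, hcC, hc⟩ := h
    obtain ⟨u, hu, huc⟩ := exists_mem_dualCode_dotProduct_eq_one hcC
    rw [dualCode_dualCode] at hu
    rw [dotProduct_comm] at huc
    exact ⟨u, hu, fun hu' => zero_ne_one ((hu' c hcD).symm.trans huc), fun _ => ⟨c, hcD, huc, hc⟩⟩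
  · obtain ⟨u, hu, hu'⟩ := SetLike.exists_of_lt hdual
    exact ⟨u, hu, fun hD => hu' (dualCode_anti hCD hD), fun h' => absurd h' h⟩

/-- Dual bases adapted to the periodic extensions of `dualCode D ≤ C ≤ H ≤ D`, in the order of the virtual
qubits: `k = 2 kc - n` vectors of `C` (logical), `y` vectors of `H`, `kd - kc` vectors of `C`, a basis of
`dualCode D` (`X`-type stabilizers), and the rest (`Z`-type stabilizers). As `m + r = y + (kd - kc)`, the two
middle groups are the classical bits followed by the gauge qubits. -/
theorem exists_adapted_dualBases {n N kc kd y m r : ℕ} [NeZero n]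
    {C D H : Submodule (ZMod 2) (Fin n → ZMod 2)} (hn : n ≤ N)
    (hC : Module.finrank (ZMod 2) C = kc) (hD : Module.finrank (ZMod 2) D = kd)
    (hH : Module.finrank (ZMod 2) H = kc + y) (hdual : dualCode C < C) (hCD : C ≤ D) (hHD : H ≤ D)
    (hk : kc < kd) (hmr : m + r = y + (kd - kc)) {u : Fin n → ZMod 2} (hu : u ∈ C)
    (hu' : u ∉ dualCode D) :
    2 * kc - n + m + r ≤ N ∧
    ∃ (B : DualBases N) (τ : Fin N → Prop) (_ : DecidablePred τ),
      (∀ i : Fin N, (2 * kc - n + m + r ≤ i.val ∧ ¬τ i) ∨ B.e i ∈ D.map (periodicExtension n N)) ∧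
      (∀ i : Fin N, 2 * kc - n + m + r ≤ i.val → τ i →
        B.e i ∈ (dualCode D).map (periodicExtension n N)) ∧
      ((dualCode D).map (periodicExtension n N) ≤
        Submodule.span (ZMod 2) {x | ∃ i : Fin N, (2 * kc - n + m + r ≤ i.val ∧ τ i) ∧ x = B.e i}) ∧
      (∃ i₀ : Fin N, i₀.val < 2 * kc - n ∧ B.e i₀ = periodicExtension n N u) ∧
      (∀ i : Fin N, B.e i ∈ C.map (periodicExtension n N) ∨
        (¬τ i ∧ (2 * kc - n + m + r ≤ i.val ∨
          (2 * kc - n ≤ i.val ∧ i.val < 2 * kc - n + y)))) ∧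
      (∀ i : Fin N, 2 * kc - n ≤ i.val → i.val < 2 * kc - n + y →
        B.e i ∈ H.map (periodicExtension n N)) := by
  have hinj := periodicExtension_injective (n := n) (N := N) hn
  have hrank : ∀ W : Submodule (ZMod 2) (Fin n → ZMod 2),
      Module.finrank (ZMod 2) (W.map (periodicExtension n N)) = Module.finrank (ZMod 2) W :=
    fun W => (LinearEquiv.finrank_eq (Submodule.equivMapOfInjective _ hinj W)).symm
  have h1 := finrank_dualCode C
  have h2 := finrank_dualCode D
  have h3 := Submodule.finrank_lt_finrank_of_lt hdual
  have h4 := Submodule.finrank_le D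
  have h5 := Submodule.finrank_le H
  have h6 := Submodule.finrank_mono hHD
  rw [Module.finrank_fin_fun] at h4 h5
  obtain ⟨k, hk'⟩ : ∃ k, k = 2 * kc - n := ⟨_, rfl⟩
  obtain ⟨δ, hδ⟩ : ∃ δ, δ = kd - kc := ⟨_, rfl⟩
  obtain ⟨p, hp⟩ : ∃ p, p = n - kd := ⟨_, rfl⟩
  rw [← hk']
  rw [← hδ] at hmr
  obtain ⟨e, he, he0, heL, heY, heB, heA⟩ := exists_linearIndependent_adapted (N := N) (k := k)
    (y := y) (δ := δ) (p := p) (Module.finrank_fin_fun (ZMod 2)) ((dualCode D).map (periodicExtension n N))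
    (C.map (periodicExtension n N)) (H.map (periodicExtension n N))
    (by rw [hrank]; omega) (by rw [hrank]; omega) (by rw [hrank]; omega) (by omega)
    (Submodule.mem_map_of_mem hu) (x := periodicExtension n N u)
    (fun h => hu' (by
      obtain ⟨w, hw, hwu⟩ := h
      exact hinj hwu ▸ hw))
  obtain ⟨B, rfl⟩ := exists_dualBases e he
  have hCDm := Submodule.map_mono (f := periodicExtension n N) hCD
  have hHDm := Submodule.map_mono (f := periodicExtension n N) hHD
  have hDCm := Submodule.map_mono (f := periodicExtension n N) ((dualCode_anti hCD).trans hdual.le)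
  refine ⟨by omega, B, fun i => k + y ≤ i.val ∧ i.val < k + y + δ + p, fun i => inferInstance,
    fun i => ?_, fun i hi hi' => heA i (by omega) hi'.2, ?_, ⟨⟨0, by omega⟩, by simp only; omega, he0 _ rfl⟩,
    fun i => ?_, heY⟩
  · by_cases i1 : i.val < k
    · exact Or.inr (hCDm (heL i i1))
    by_cases i2 : i.val < k + y
    · exact Or.inr (hHDm (heY i (by omega) i2))
    by_cases i3 : i.val < k + y + δ
    · exact Or.inr (hCDm (heB i (by omega) i3))
    by_cases i4 : i.val < k + y + δ + p
    · exact Or.inr (hCDm (hDCm (heA i (by omega) i4)))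
    · exact Or.inl ⟨by omega, by omega⟩
  · -- There are `p = finrank (dualCode D)` independent vectors in these positions.
    let ι : Fin p → Fin N := fun j => ⟨k + y + δ + j, by omega⟩
    have hι : Function.Injective ι := by
      intro i j hij
      ext
      simpa [ι] using hij
    have hle : Submodule.span (ZMod 2) (Set.range (B.e ∘ ι)) ≤
        (dualCode D).map (periodicExtension n N) := by
      rw [Submodule.span_le]
      rintro _ ⟨j, rfl⟩
      exact heA _ (Nat.le_add_right _ _) (Nat.add_lt_add_left j.isLt _)
    have heq := Submodule.eq_of_le_of_finrank_eq hle (by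
      rw [finrank_span_eq_card (he.comp ι hι), Fintype.card_fin, hrank, h2, hD, hp])
    rw [← heq]
    refine Submodule.span_mono ?_
    rintro _ ⟨j, rfl⟩
    have hj := j.isLt
    exact ⟨ι j, ⟨by simp only [ι]; omega, by simp only [ι]; omega, by simp only [ι]; omega⟩, rfl⟩
  · by_cases i1 : i.val < k
    · exact Or.inl (heL i i1)
    by_cases i2 : i.val < k + y
    · exact Or.inr ⟨by omega, Or.inr ⟨by omega, i2⟩⟩
    by_cases i3 : i.val < k + y + δ
    · exact Or.inl (heB i (by omega) i3)
    by_cases i4 : i.val < k + y + δ + p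
    · exact Or.inl (hDCm (heA i (by omega) i4))
    · exact Or.inr ⟨by omega, Or.inl (by omega)⟩

section Codes

variable {n kc dc kd dd : ℕ} {C D : Submodule (ZMod 2) (Fin n → ZMod 2)}

theorem neZero_of_dualCode_lt (hdual : dualCode C < C) : NeZero n := by
  refine ⟨?_⟩
  rintro rfl
  exact hdual.ne (Subsingleton.elim _ _)

/-- Without sign translation, and with `H = D`. -/
theorem exists_nonSynchronizable_code (hC : IsLinearCode C kc dc) (hD : IsLinearCode D kd dd)
    (hdual : dualCode C < C) (hCD : C < D) (hk : kc < kd) {m r : ℕ}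
    (hmr : m + r = 2 * (kd - kc)) :
    ∃ Q : HybridSubsystemCode n (2 * kc - n) m r, HasDesignDistance C D dd Q ∧
      Q.NonSynchronizable ∧ Q.syncDistance n 0 0 ((dd - 1) / 2) = 1 := by
  have := neZero_of_dualCode_lt hdual
  obtain ⟨u, hu, hu', huc⟩ := exists_mem_notMem_dualCode (dd := dd) hdual hCD.le
  obtain ⟨hsize, B, τ, _, hED, hE, hspan, ⟨i₀, hi₀, hi₀u⟩, -, -⟩ :=
    exists_adapted_dualBases (y := kd - kc) (m := m) (r := r) (H := D) le_rfl hC.1 hD.1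
      (by rw [hD.1]; omega) hdual hCD.le le_rfl hk (by omega) hu hu'
  exact ⟨cssCode B τ 0 hsize, hasDesignDistance_cssCode le_rfl hD hED hE hspan hi₀ hi₀u huc,
    nonSynchronizable_cssCode, HybridSubsystemCode.syncDistance_zero_zero _ _ _⟩

/-- With a generator `g` of `D`, the sign translation `T ^ y g`, and `y` classical bits that translate the
code words within the span of `C` and `g, …, T ^ (y - 1) g`. -/
theorem exists_synchronizable_code (hCcyc : IsCyclicCode C) (hDcyc : IsCyclicCode D)
    (hC : IsLinearCode C kc dc) (hD : IsLinearCode D kd dd)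
    (hdual : dualCode C < C) (hCD : C < D) (hk : kc < kd) {y m r : ℕ} (hym : y ≤ m)
    (hmr : m + r = y + (kd - kc)) (al ar : ℕ) (ha : al + ar < kd - kc - y) :
    ∃ Q : HybridSubsystemCode (n + al + ar) (2 * kc - n) m r, HasDesignDistance C D dd Q ∧
      Q.CorrectsMisalignment n al al ar ((dd - 1) / 2) := by
  have := neZero_of_dualCode_lt hdual
  obtain ⟨g, hg, hgen⟩ := hDcyc.exists_generator
  obtain ⟨u, hu, hu', huc⟩ := exists_mem_notMem_dualCode (dd := dd) hdual hCD.le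
  have hHD := shiftFlag_le (C := C) hDcyc hCD.le hg y
  have hH : Module.finrank (ZMod 2) (shiftFlag C g y) = kc + y := by
    rw [finrank_shiftFlag hCcyc hgen (by rw [hC.1, hD.1]; omega), hC.1]
  have hdd : 0 < dd := by
    obtain ⟨c, -, hc0, hc⟩ := hD.2.1
    exact hc ▸ hammingNorm_pos_iff.2 hc0
  have hn : n ≤ n + al + ar := by omega
  obtain ⟨hsize, B, τ, _, hED, hE, hspan, ⟨i₀, hi₀, hi₀u⟩, hEC, hEH⟩ :=
    exists_adapted_dualBases (m := m) (r := r) hn hC.1 hD.1 hH hdual hCD.le hHD hk hmr hu hu'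
  refine ⟨cssCode B τ (periodicExtension n _ ((cyclicShift n ^ y) g)) hsize,
    hasDesignDistance_cssCode hn hD hED hE hspan hi₀ hi₀u huc,
    correctsMisalignment_cssCode rfl hym hCcyc hDcyc hD (by omega) hCD.le hHD
      (hDcyc.cyclicShift_pow_mem hg y) rfl hEC hEH fun s s' hss hs h hh h' hh' => ?_⟩
  exact shift_add_shift_notMem hCcyc hgen hss (by rw [hC.1, hD.1]; omega) hh hh'

theorem exists_synchronizable_family (hCcyc : IsCyclicCode C) (hDcyc : IsCyclicCode D)
    (hC : IsLinearCode C kc dc) (hD : IsLinearCode D kd dd)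
    (hdual : dualCode C < C) (hCD : C < D) (hk : kc < kd) {y m r a : ℕ} (hym : y ≤ m)
    (hmr : m + r = y + (kd - kc)) (ha : a = kd - kc - y) (hpos : 0 < a) :
    ∃ Q : ∀ al ar : ℕ, al + ar < a → HybridSubsystemCode (n + al + ar) (2 * kc - n) m r,
      (∀ (al ar : ℕ) (h : al + ar < a), HasDesignDistance C D dd (Q al ar h) ∧
        (Q al ar h).CorrectsMisalignment n al al ar ((dd - 1) / 2)) ∧
      IsGreatest {s | ∃ (al ar : ℕ) (h : al + ar < a),
        s = (Q al ar h).syncDistance n al ar ((dd - 1) / 2)} a := by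
  subst ha
  choose Q hQ using fun al ar => exists_synchronizable_code hCcyc hDcyc hC hD hdual hCD hk hym hmr al ar
  refine ⟨Q, hQ, ⟨kd - kc - y - 1, 0, by omega, ?_⟩, ?_⟩
  · rw [HybridSubsystemCode.syncDistance_eq (hQ _ _ _).2]
    omega
  · rintro _ ⟨al, ar, h, rfl⟩
    rw [HybridSubsystemCode.syncDistance_eq (hQ al ar h).2]
    omega

end Codes

theorem mainTheorem1 {n : ℕ} (C D : Submodule (ZMod 2) (Fin n → ZMod 2)) (kc dc kd dd : ℕ)
    (hCcyc : IsCyclicCode C) (hDcyc : IsCyclicCode D)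
    (hC : IsLinearCode C kc dc) (hD : IsLinearCode D kd dd)
    (hdual : dualCode C < C) (hCD : C < D) (hk : kc < kd) :
    -- a subsystem code
    (∃ Q : SubsystemCode n (2 * kc - n) (2 * (kd - kc)),
      HasDesignDistance C D dd Q ∧ Q.NonSynchronizable ∧
      Q.syncDistance n 0 0 ((dd - 1) / 2) = 1) ∧
    -- synchronizable subsystem codes
    (∃ Q : ∀ al ar : ℕ, al + ar < kd - kc → SubsystemCode (n + al + ar) (2 * kc - n) (kd - kc),
      (∀ (al ar : ℕ) (h : al + ar < kd - kc),
        HasDesignDistance C D dd (Q al ar h) ∧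
        (Q al ar h).CorrectsMisalignment n al al ar ((dd - 1) / 2)) ∧
      IsGreatest {s | ∃ (al ar : ℕ) (h : al + ar < kd - kc),
        s = (Q al ar h).syncDistance n al ar ((dd - 1) / 2)} (kd - kc)) ∧
    -- synchronizable hybrid codes
    (∃ Q : ∀ al ar : ℕ, al + ar < kd - kc → HybridCode (n + al + ar) (2 * kc - n) (kd - kc),
      (∀ (al ar : ℕ) (h : al + ar < kd - kc),
        HasDesignDistance C D dd (Q al ar h) ∧
        (Q al ar h).CorrectsMisalignment n al al ar ((dd - 1) / 2)) ∧
      IsGreatest {s | ∃ (al ar : ℕ) (h : al + ar < kd - kc),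
        s = (Q al ar h).syncDistance n al ar ((dd - 1) / 2)} (kd - kc)) ∧
    -- synchronizable hybrid codes with more classical bits
    (∀ y : ℕ, 1 ≤ y → y + 2 ≤ kd - kc →
      ∃ Q : ∀ al ar : ℕ, al + ar < kd - kc - y → HybridCode (n + al + ar) (2 * kc - n) (kd - kc + y),
      (∀ (al ar : ℕ) (h : al + ar < kd - kc - y),
        HasDesignDistance C D dd (Q al ar h) ∧
        (Q al ar h).CorrectsMisalignment n al al ar ((dd - 1) / 2)) ∧
      IsGreatest {s | ∃ (al ar : ℕ) (h : al + ar < kd - kc - y),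
        s = (Q al ar h).syncDistance n al ar ((dd - 1) / 2)} (kd - kc - y)) ∧
    -- a hybrid code
    (∃ Q : HybridCode n (2 * kc - n) (2 * (kd - kc)),
      HasDesignDistance C D dd Q ∧ Q.NonSynchronizable ∧
      Q.syncDistance n 0 0 ((dd - 1) / 2) = 1) ∧
    -- synchronizable hybrid subsystem codes
    (∀ y : ℕ, 1 ≤ y → y + 2 ≤ kd - kc →
      ∃ Q : ∀ al ar : ℕ, al + ar < kd - kc - y → HybridSubsystemCode (n + al + ar) (2 * kc - n) y (kd - kc),
      (∀ (al ar : ℕ) (h : al + ar < kd - kc - y),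
        HasDesignDistance C D dd (Q al ar h) ∧
        (Q al ar h).CorrectsMisalignment n al al ar ((dd - 1) / 2)) ∧
      IsGreatest {s | ∃ (al ar : ℕ) (h : al + ar < kd - kc - y),
        s = (Q al ar h).syncDistance n al ar ((dd - 1) / 2)} (kd - kc - y)) ∧
    -- a hybrid subsystem code
    (∃ Q : HybridSubsystemCode n (2 * kc - n) (kd - kc) (kd - kc),
      HasDesignDistance C D dd Q ∧ Q.NonSynchronizable ∧
      Q.syncDistance n 0 0 ((dd - 1) / 2) = 1) := by
  refine ⟨?_, ?_, ?_, fun y hy hy' => ?_, ?_, fun y hy hy' => ?_, ?_⟩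
  · exact exists_nonSynchronizable_code hC hD hdual hCD hk (by omega)
  · exact exists_synchronizable_family hCcyc hDcyc hC hD hdual hCD hk (y := 0) (by omega) (by omega)
      (by omega) (by omega)
  · exact exists_synchronizable_family hCcyc hDcyc hC hD hdual hCD hk (y := 0) (by omega) (by omega)
      (by omega) (by omega)
  · exact exists_synchronizable_family hCcyc hDcyc hC hD hdual hCD hk (y := y) (by omega) (by omega)
      rfl (by omega)
  · exact exists_nonSynchronizable_code hC hD hdual hCD hk (by omega)
  · exact exists_synchronizable_family hCcyc hDcyc hC hD hdual hCD hk (y := y) (by omega) (by omega)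
      rfl (by omega)
  · exact exists_nonSynchronizable_code hC hD hdual hCD hk (by omega)
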